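/- **Setting.** Consider $u_t+\beta u_x=0$ with constant $\beta>0$ and periodic boundary conditions on $\Omega=[a,b]$. Partition $[a,b]$ into finitely many cells $I_i=[x_{i-1/2},x_{i+1/2}]$ of size $h_i$, let $h=\max_i h_i$, and assume quasi-uniformity, $h\le\mu h_i$ for all $i$. Fix $k\ge 0$ and let $\mathbb V^k$ be the space of functions that are polynomials of degree $\le k$ on each cell (with one-sided traces $v^\pm$, derivative $v_x$ taken cell by cell, and jumps $[\![v]\!]=v^+-v^-$, the last cell being followed periodically by the first). Each cell is subdivided by $x_{i-1/2}=x_{i,0}<x_{i,1}<\dots<x_{i,k+1}=x_{i+1/2}$ into control volumes $I_{i,j}=[x_{i,j},x_{i,j+1}]$, $0\le j\le k$. Let $Q_i(v)=\sum_{j=0}^{k+1}A_{i,j}v(x_{i,j})$ be quadrature rules on these points such that 1. $Q_i(p)=\int_{I_i}p\,dx$ for all polynomials $p$ of degree $\le 2k-1$; 2. if $k\ge1$, $\frac{h_i}{2k-1}-Q_i(L_{i,k+1}L_{i,k-1})\ge\delta h_i$ for all $i$, where $\delta>0$ and $L_{i,\ell}$ is the Legendre polynomial of degree $\ell$ shifted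 to $I_i$, with $\int_{I_i}L_{i,\ell}^2\,dx=\frac{h_i}{2\ell+1}$; 3. (upwind condition) $A_{i,0}=0$ for all $i$. For $\omega\in\mathbb V^k$ let $M^*\omega$ be the function that is constant on each $I_{i,j}$, with $(M^*\omega)|_{I_{i,0}}=\omega^+_{i-1/2}+A_{i,0}\,\omega_x(x_{i,0}^+)$ and $(M^*\omega)|_{I_{i,j}}-(M^*\omega)|_{I_{i,j-1}}=A_{i,j}\,\omega_x(x_{i,j})$ for $1\le j\le k$. Put $(v,\omega)_*=\int_\Omega v\,M^*\omega\,dx$ and $\|v\|_*=\sqrt{(v,v)_*}$, which is a norm on $\mathbb V^k$. Consider an explicit $s$-stage Runge–Kutta method with coefficients $c_{\ell\kappa},d_{\ell\kappa}$ ($0\le\kappa\le\ell<s$), $\sum_{\kappa\le\ell}c_{\ell\kappa}=1$, of order $r\ge1$ (only the order for linear equations is used: the stability polynomial agrees with $e^z$ up to $O(z^{r+1})$). The RKSV scheme with step size $\tau>0$ computes $u_h^{n+1}=u_h^{n,s}$ from $u_h^{n,0}=u_h^n\in\mathbb V^k$ by stages $u_h^{n,\ell}\in\mathbb V^k$ with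 $$\int_{I_{i,j}}u_h^{n,\ell+1}dx=\sum_{0\le\kappa\le\ell}\Big(c_{\ell\kappa}\int_{I_{i,j}}u_h^{n,\kappa}dx+\tau d_{\ell\kappa}\beta\big(u_h^{n,\kappa}(x_{i,j}^-)-u_h^{n,\kappa}(x_{i,j+1}^-)\big)\Big)\quad\forall i,j,$$ or in the Galerkin form $$(u_h^{n,\ell+1},\omega)_*=\sum_{0\le\kappa\le\ell}\big(c_{\ell\kappa}(u_h^{n,\kappa},\omega)_*+\tau d_{\ell\kappa}\mathcal H^*(u_h^{n,\kappa},\omega)\big)\quad\forall\omega\in\mathbb V^k,$$ $$\mathcal H^*(v,\omega)=\beta\Big(\sum_iQ_i(v\,\omega_x)+\sum_iv^-_{i+1/2}[\![\omega]\!]_{i+1/2}-\sum_iA_{i+1,0}\,(\omega_x)^+_{i+1/2}[\![v]\!]_{i+1/2}\Big).$$ **Theorem (weak($\gamma_0$) stability of the RKSV scheme).** For every such Runge–Kutta method there is $\gamma_0\ge2$ such that for all $k\ge0$, $\beta>0$, $\mu$ and $\delta>0$ there are constants $C_{\mathrm{CFL}}>0$ and $C\ge0$, independent of $a,b$, the mesh,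 the subdivision, $h$, $\tau$, $n$ and the solution, with $$\|u_h^{n+1}\|_*^2\le\Big(1+C\Big(\frac\tau h\Big)^{\gamma_0}\Big)\|u_h^n\|_*^2\qquad\text{for all }n,\text{ whenever }\frac\tau h\le C_{\mathrm{CFL}},$$ for every numerical solution of the RKSV scheme, in either form. The constant $C$ can be $0$: there is such a Runge–Kutta method for which, for all $k,\beta,\mu,\delta$ and a suitable $C_{\mathrm{CFL}}>0$, the estimate holds with $C=0$. -/

import Mathlib

open Polynomial

noncomputable section

namespace SpectralVolume

/-- An `s`-stage explicit Runge--Kutta method in Shu--Osher form: the new stage `ℓ + 1` is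
`∑ κ ≤ ℓ, (c ℓ κ • u_κ + τ d ℓ κ • L u_κ)`, where `∑ κ ≤ ℓ, c ℓ κ = 1`. Only the entries with
`κ ≤ ℓ < s` are used. -/
structure RKMethod where
  s : ℕ
  c : ℕ → ℕ → ℝ
  d : ℕ → ℕ → ℝ
  sum_c : ∀ ℓ < s, ∑ κ ∈ Finset.range (ℓ + 1), c ℓ κ = 1

/-- The stages of a Runge--Kutta method for the linear equation `u' = L u`, started from `1`, as
polynomials in `z = τ L`. -/
def RKMethod.stagePoly (rk : RKMethod) : ℕ → ℝ[X]
  | 0 => 1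
  | ℓ + 1 => ∑ κ : Fin (ℓ + 1),
      (C (rk.c ℓ κ) + C (rk.d ℓ κ) * X) * rk.stagePoly κ

/-- The method has order (at least) `r` for linear equations `u' = L u`: its stability polynomial
agrees with `exp z` up to `O(z ^ (r + 1))`. A method of classical order `r` has this property. -/
def RKMethod.HasOrder (rk : RKMethod) (r : ℕ) : Prop :=
  ∀ m ≤ r, (rk.stagePoly rk.s).coeff m = 1 / (m.factorial : ℝ)

/-- A partition of an interval `[a, b]` into the `m + 1` cells
`I_i = [node i, node (i + 1)]`, `a = node 0`, `b = node (m + 1)`, together with a subdivision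
of each cell into `k + 1` control volumes `[pt i j, pt i (j + 1)]`. -/
structure SVMesh (k : ℕ) where
  m : ℕ
  node : Fin (m + 2) → ℝ
  node_strictMono : StrictMono node
  pt : Fin (m + 1) → Fin (k + 2) → ℝ
  pt_strictMono : ∀ i, StrictMono (pt i)
  pt_zero : ∀ i, pt i 0 = node i.castSucc
  pt_last : ∀ i, pt i (Fin.last (k + 1)) = node i.succ

namespace SVMesh

variable {k : ℕ}

/-- The left end point of a cell. -/
def left (M : SVMesh k) (i : Fin (M.m + 1)) : ℝ := M.node i.castSucc

/-- The right end point of a cell. -/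
def right (M : SVMesh k) (i : Fin (M.m + 1)) : ℝ := M.node i.succ

/-- The size `h_i` of a cell. -/
def width (M : SVMesh k) (i : Fin (M.m + 1)) : ℝ := M.right i - M.left i

/-- The mesh size `h = max h_i`. -/
def size (M : SVMesh k) : ℝ := ⨆ i, M.width i

/-- The piecewise polynomial space `𝕍^k`: one polynomial of degree `≤ k` on each cell. -/
abbrev Space (M : SVMesh k) : Type :=
  Fin (M.m + 1) → Polynomial.degreeLE ℝ (k : WithBot ℕ)

/-- The trace `v⁺` at the left end point of cell `i`, taken from inside the cell. -/
def leftTrace (M : SVMesh k) (v : M.Space) (i : Fin (M.m + 1)) : ℝ :=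
  (v i : ℝ[X]).eval (M.left i)

/-- The trace `v⁻` at the right end point of cell `i`, taken from inside the cell. -/
def rightTrace (M : SVMesh k) (v : M.Space) (i : Fin (M.m + 1)) : ℝ :=
  (v i : ℝ[X]).eval (M.right i)

/-- The jump `v⁺ - v⁻` at the interface between cell `i` and cell `i + 1`. By periodicity the
addition in `Fin (m + 1)` is cyclic: the last cell is followed by cell `0`. -/
def jump (M : SVMesh k) (v : M.Space) (i : Fin (M.m + 1)) : ℝ :=
  M.leftTrace v (i + 1) - M.rightTrace v i

/-- Quadrature weights `A_{i,j}` at the points `pt i j`. -/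
abbrev Weights (M : SVMesh k) : Type := Fin (M.m + 1) → Fin (k + 2) → ℝ

/-- The quadrature rule `Q_i` of cell `i`. -/
def quad (M : SVMesh k) (A : M.Weights) (i : Fin (M.m + 1)) (p : ℝ[X]) : ℝ :=
  ∑ j, A i j * p.eval (M.pt i j)

/-- The shifted Legendre polynomial `L_{i,ℓ}` on cell `i`, equal to `1` at the right end point
(Mathlib's polynomial lives on `[0, 1]` and equals `1` at `0`). -/
def legendre (M : SVMesh k) (i : Fin (M.m + 1)) (l : ℕ) : ℝ[X] :=
  C ((-1 : ℝ) ^ l) * ((Polynomial.shiftedLegendre l).map (Int.castRingHom ℝ)).comp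
    (C (M.width i)⁻¹ * (X - C (M.left i)))

/-- The subdivision assumption for the quadrature with weights `A`, with margin `δ`: the rule `Q_i`
is exact on polynomials of degree `≤ 2k - 1`, and
`h_i / (2k - 1) - Q_i (L_{i,k+1} L_{i,k-1}) ≥ δ h_i`. If `k = 0` there is nothing to require. -/
structure SubdivisionAssumption (M : SVMesh k) (A : M.Weights) (δ : ℝ) : Prop where
  exact : ∀ i, ∀ p : ℝ[X], p.degree < ((2 * k : ℕ) : WithBot ℕ) →
    M.quad A i p = ∫ x in (M.left i)..(M.right i), p.eval x
  margin : 1 ≤ k → ∀ i, δ * M.width i ≤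
    M.width i / (2 * (k : ℝ) - 1) - M.quad A i (M.legendre i (k + 1) * M.legendre i (k - 1))

/-- The upwind condition. -/
def Upwind (M : SVMesh k) (A : M.Weights) : Prop := ∀ i, A i 0 = 0

/-- The partition is quasi-uniform with constant `μ`. -/
def QuasiUniform (M : SVMesh k) (μ : ℝ) : Prop := ∀ i, M.size ≤ μ * M.width i

/-- The trial-to-test mapping `M^*`: the constant value of `M^* ω` on the control volume
`[pt i j, pt i (j + 1)]`. -/
def mstar (M : SVMesh k) (A : M.Weights) (ω : M.Space) (i : Fin (M.m + 1)) :
    Fin (k + 1) → ℝ :=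
  Fin.induction
    (M.leftTrace ω i + A i 0 * (derivative (ω i : ℝ[X])).eval (M.left i))
    (fun j prev => prev +
      A i j.succ.castSucc * (derivative (ω i : ℝ[X])).eval (M.pt i j.succ.castSucc))

/-- The integral of `v` over the control volume `[pt i j, pt i (j + 1)]`. -/
def cvIntegral (M : SVMesh k) (v : M.Space) (i : Fin (M.m + 1)) (j : Fin (k + 1)) : ℝ :=
  ∫ x in (M.pt i j.castSucc)..(M.pt i j.succ), (v i : ℝ[X]).eval x

/-- The form `⟨v, ω⟩_* = ⟨v, M^* ω⟩_{L²}`. -/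
def ipStar (M : SVMesh k) (A : M.Weights) (v ω : M.Space) : ℝ :=
  ∑ i, ∑ j, M.cvIntegral v i j * M.mstar A ω i j

/-- The energy norm `‖v‖_*`. -/
def normStar (M : SVMesh k) (A : M.Weights) (v : M.Space) : ℝ :=
  Real.sqrt (M.ipStar A v v)

/-- The upwind flux at `pt i j` for the flux `β u` with `β > 0` and periodic boundary conditions:
at the left end point of cell `i` it uses the trace from cell `i - 1` (cyclically). -/
def flux (M : SVMesh k) (β : ℝ) (v : M.Space) (i : Fin (M.m + 1)) (j : Fin (k + 2)) : ℝ :=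
  if j = 0 then β * M.rightTrace v (i - 1) else β * (v i : ℝ[X]).eval (M.pt i j)

/-- The spectral volume bilinear form
`β (∑ Q_i (v ω_x) + ∑ v⁻ ⟦ω⟧ - ∑ A_{i,0} (ω_x)⁺ ⟦v⟧)`, the last two sums being over the
interfaces, and the last weight and derivative being those of the cell to the right. -/
def svForm (M : SVMesh k) (A : M.Weights) (β : ℝ) (v ω : M.Space) : ℝ :=
  β * (∑ i, M.quad A i ((v i : ℝ[X]) * derivative (ω i : ℝ[X]))
    + ∑ i, M.rightTrace v i * M.jump ω i
    - ∑ i, A (i + 1) 0 * (derivative (ω (i + 1) : ℝ[X])).eval (M.left (i + 1)) * M.jump v i)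

/-- One step `u ↦ u'` of the RKSV scheme for `u_t + β u_x = 0`: the semi-discrete scheme on the
control volumes, with upwind fluxes, advanced by the Runge--Kutta method. -/
def IsRKSVStep (M : SVMesh k) (rk : RKMethod) (β τ : ℝ) (u u' : M.Space) : Prop :=
  ∃ w : ℕ → M.Space, w 0 = u ∧ w rk.s = u' ∧
    ∀ ℓ < rk.s, ∀ i j, M.cvIntegral (w (ℓ + 1)) i j =
      ∑ κ ∈ Finset.range (ℓ + 1), (rk.c ℓ κ * M.cvIntegral (w κ) i j
        + τ * rk.d ℓ κ * (M.flux β (w κ) i j.castSucc - M.flux β (w κ) i j.succ))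

/-- One step `u ↦ u'` of the RKSV scheme for `u_t + β u_x = 0` in its Galerkin form. -/
def IsGalerkinRKSVStep (M : SVMesh k) (A : M.Weights) (rk : RKMethod) (β τ : ℝ)
    (u u' : M.Space) : Prop :=
  ∃ w : ℕ → M.Space, w 0 = u ∧ w rk.s = u' ∧
    ∀ ℓ < rk.s, ∀ ω : M.Space, M.ipStar A (w (ℓ + 1)) ω =
      ∑ κ ∈ Finset.range (ℓ + 1), (rk.c ℓ κ * M.ipStar A (w κ) ω
        + τ * rk.d ℓ κ * M.svForm A β (w κ) ω)

end SVMesh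

/-- The estimate `‖u^{n+1}‖_*² ≤ (1 + K (τ/h)^γ₀) ‖u^n‖_*²`, at every step of every numerical
solution of the RKSV scheme (in either form), under the step-size restriction `τ/h ≤ Ccfl`, on all
meshes with quasi-uniformity constant `μ` and all subdivisions that satisfy the subdivision
assumption with margin `δ` and the upwind condition. -/
def WeakStability (rk : RKMethod) (k : ℕ) (β μ δ Ccfl γ₀ K : ℝ) : Prop :=
  ∀ (M : SVMesh k) (A : M.Weights), M.QuasiUniform μ → M.SubdivisionAssumption A δ →
    M.Upwind A → ∀ τ : ℝ, 0 < τ → τ / M.size ≤ Ccfl →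
    ∀ (N : ℕ) (u : ℕ → M.Space),
      ((∀ n < N, M.IsRKSVStep rk β τ (u n) (u (n + 1))) ∨
        (∀ n < N, M.IsGalerkinRKSVStep A rk β τ (u n) (u (n + 1)))) →
      ∀ n < N, M.normStar A (u (n + 1)) ^ 2 ≤
        (1 + K * (τ / M.size) ^ γ₀) * M.normStar A (u n) ^ 2

end SpectralVolume

end

open SpectralVolume

open Polynomial

noncomputable section

namespace SpectralVolume

/-! ### Polynomials of a small dissipative operator on an inner product space. -/

section Abstract

variable {E : Type*} [NormedAddCommGroup E] [InnerProductSpace ℝ E]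

/-! The scheme is an explicit Runge–Kutta method for `u' = L u`, where `L` represents the spectral
volume form in the energy inner product. Three facts suffice: the energy form is an inner product,
`L` is dissipative for it, and `‖τ L‖ ≤ G τ / h` with `G` depending only on `k`, `β`, `μ`, `δ`.

Energy form: pulled back to the unit cell it is `∫ v w + E (V w')`, with `V' = v`, `V 0 = 0` and `E`
the quadrature error. Since `E` kills degree at most `2k - 1` and `V w'` has degree at most `2k`,
only leading coefficients enter the correction. Hence the form is symmetric, and the Legendre margin
`δ` is exactly what keeps the top Legendre mode coercive (`coercivity_unit_cell`).

Spectral volume form: `v w_x` has degree at most `2k - 1`, so with `A_{i,0} = 0` the form is the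
upwind discontinuous Galerkin form, and `H(v, v) = -(β/2) ∑ ⟦v⟧² ≤ 0`. Inverse estimates on the unit
cell bound it without any power of `h`; the factor `1/h` appears when the `L²` norms on the unit
cell are compared with the energy.

Time stepping: a first-order method has stability polynomial `1 + z + z² S(z)`. In `‖p(τL) u‖²` the
only term of first order in `τ` is `2⟨τ L u, u⟩ ≤ 0`; the rest is `O((τ/h)²)`, so `γ₀ = 2` always
works (`norm_sq_aeval_apply_le`). For `1 + z + z²` the energy does not grow at all
(`norm_sq_quadratic_apply_le`), which gives `C = 0`. -/

lemma norm_pow_apply_le {T : E →ₗ[ℝ] E} (hT : ∀ u, ‖T u‖ ≤ ‖u‖) (n : ℕ) (u : E) :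
    ‖(T ^ n) u‖ ≤ ‖u‖ := by
  induction n with
  | zero => simp
  | succ n ih =>
    rw [pow_succ', Module.End.mul_apply]
    exact (hT _).trans ih

/-- The sum of the absolute values of the coefficients. -/
def coeffNorm (p : ℝ[X]) : ℝ := ∑ i ∈ Finset.range (p.natDegree + 1), |p.coeff i|

lemma coeffNorm_nonneg (p : ℝ[X]) : 0 ≤ coeffNorm p :=
  Finset.sum_nonneg fun _ _ => abs_nonneg _

lemma norm_aeval_apply_le {T : E →ₗ[ℝ] E} (hT : ∀ u, ‖T u‖ ≤ ‖u‖) (p : ℝ[X]) (u : E) :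
    ‖aeval T p u‖ ≤ coeffNorm p * ‖u‖ := by
  rw [aeval_eq_sum_range, LinearMap.sum_apply, coeffNorm, Finset.sum_mul]
  refine (norm_sum_le _ _).trans (Finset.sum_le_sum fun i _ => ?_)
  rw [LinearMap.smul_apply, norm_smul, Real.norm_eq_abs]
  exact mul_le_mul_of_nonneg_left (norm_pow_apply_le hT i u) (abs_nonneg _)

/-- The constant of the quadratic growth bound for a polynomial `1 + X + ⋯` of a dissipative
operator. -/
def growthConst (p : ℝ[X]) : ℝ :=
  2 * coeffNorm p.divX.divX + (1 + coeffNorm p.divX.divX) ^ 2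

lemma growthConst_nonneg (p : ℝ[X]) : 0 ≤ growthConst p := by
  have := coeffNorm_nonneg p.divX.divX
  unfold growthConst
  positivity

theorem norm_sq_aeval_apply_le {T : E →ₗ[ℝ] E} (hneg : ∀ u, inner ℝ (T u) u ≤ 0) {θ : ℝ}
    (hθ₀ : 0 ≤ θ) (hθ₁ : θ ≤ 1) (hT : ∀ u, ‖T u‖ ≤ θ * ‖u‖) {p : ℝ[X]}
    (h0 : p.coeff 0 = 1) (h1 : p.coeff 1 = 1) (u : E) :
    ‖aeval T p u‖ ^ 2 ≤ (1 + growthConst p * θ ^ 2) * ‖u‖ ^ 2 := by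
  set S := p.divX.divX with hS
  have hT' : ∀ u, ‖T u‖ ≤ ‖u‖ := fun u =>
    (hT u).trans (mul_le_of_le_one_left (norm_nonneg _) hθ₁)
  have hp : p = 1 + X + X ^ 2 * S := by
    have e1 : p.divX = X * S + C 1 := by
      rw [hS]
      conv_lhs => rw [← X_mul_divX_add p.divX]
      rw [coeff_divX, zero_add, h1]
    conv_lhs => rw [← X_mul_divX_add p, h0, e1]
    simp only [map_one]
    ring
  have hpu : aeval T p u = u + (T u + T (T (aeval T S u))) := by
    rw [hp]
    simp [pow_two, add_assoc]
  set σ := coeffNorm S with hσ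
  have hσ₀ : 0 ≤ σ := coeffNorm_nonneg S
  set y := T (T (aeval T S u)) with hy
  have hyn : ‖y‖ ≤ θ ^ 2 * σ * ‖u‖ := by
    calc ‖y‖ ≤ θ * (θ * (σ * ‖u‖)) := by
          refine (hT _).trans (mul_le_mul_of_nonneg_left ?_ hθ₀)
          exact (hT _).trans (mul_le_mul_of_nonneg_left (norm_aeval_apply_le hT' S u) hθ₀)
      _ = _ := by ring
  have hin : inner ℝ u y ≤ θ ^ 2 * σ * ‖u‖ ^ 2 := by
    calc inner ℝ u y ≤ ‖u‖ * ‖y‖ := real_inner_le_norm _ _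
      _ ≤ ‖u‖ * (θ ^ 2 * σ * ‖u‖) := mul_le_mul_of_nonneg_left hyn (norm_nonneg _)
      _ = _ := by ring
  -- Here `θ ≤ 1` is used to lower `θ ^ 2` to `θ`, so that the square is again of order `θ ^ 2`.
  have hsum : ‖T u + y‖ ≤ θ * (1 + σ) * ‖u‖ := by
    have : θ ^ 2 * σ * ‖u‖ ≤ θ * σ * ‖u‖ := by
      gcongr
      nlinarith
    calc ‖T u + y‖ ≤ ‖T u‖ + ‖y‖ := norm_add_le _ _
      _ ≤ θ * ‖u‖ + θ * σ * ‖u‖ := add_le_add (hT u) (hyn.trans this)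
      _ = _ := by ring
  have hsq : ‖T u + y‖ ^ 2 ≤ θ ^ 2 * (1 + σ) ^ 2 * ‖u‖ ^ 2 := by
    calc ‖T u + y‖ ^ 2 ≤ (θ * (1 + σ) * ‖u‖) ^ 2 := pow_le_pow_left₀ (norm_nonneg _) hsum 2
      _ = _ := by ring
  have hTu := hneg u
  rw [real_inner_comm] at hTu
  rw [hpu, norm_add_sq_real, inner_add_right, growthConst, ← hS, ← hσ]
  linarith

theorem norm_sq_quadratic_apply_le {T : E →ₗ[ℝ] E} (hneg : ∀ u, inner ℝ (T u) u ≤ 0)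
    (hT : ∀ u, ‖T u‖ ≤ ‖u‖) (u : E) : ‖u + T u + T (T u)‖ ^ 2 ≤ ‖u‖ ^ 2 := by
  -- Dissipativity tested on `u + T u` instead of `u` absorbs every mixed term and leaves the
  -- surplus `-‖T u‖ ^ 2`, which pays for `‖T (T u)‖ ^ 2`.
  have key : ‖u + T u + T (T u)‖ ^ 2 =
      ‖u‖ ^ 2 + 2 * inner ℝ (T (u + T u)) (u + T u) - ‖T u‖ ^ 2 + ‖T (T u)‖ ^ 2 := by
    rw [norm_add_sq_real, norm_add_sq_real]
    simp only [map_add, inner_add_left, inner_add_right, real_inner_self_eq_norm_sq]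
    rw [real_inner_comm u (T u), real_inner_comm u (T (T u)), real_inner_comm (T u) (T (T u))]
    ring
  have h1 := hneg (u + T u)
  have h2 : ‖T (T u)‖ ^ 2 ≤ ‖T u‖ ^ 2 := pow_le_pow_left₀ (norm_nonneg _) (hT _) 2
  linarith

lemma exists_bilin_norm_bound [FiniteDimensional ℝ E] (G : E →ₗ[ℝ] E →ₗ[ℝ] ℝ) :
    ∃ c : ℝ, 0 ≤ c ∧ ∀ v w, |G v w| ≤ c * ‖v‖ * ‖w‖ :=
  ⟨‖G.toContinuousBilinearMap‖, ContinuousLinearMap.opNorm_nonneg _,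
    fun v w => G.toContinuousBilinearMap.le_opNorm₂ v w⟩

end Abstract

/-! ### Galerkin Runge–Kutta steps for an abstract positive definite form. -/

section Galerkin

variable {V : Type*} [AddCommGroup V] [Module ℝ V]

/-- Definiteness of `B` means that the Galerkin equations determine each stage, so any numerical
solution is a polynomial in `τ • L` applied to the initial value. -/
theorem eq_stagePoly_of_galerkin {B H : V →ₗ[ℝ] V →ₗ[ℝ] ℝ} (hpos : ∀ v, v ≠ 0 → 0 < B v v)
    {L : V →ₗ[ℝ] V} (hL : ∀ v w, B (L v) w = H v w) (rk : RKMethod) (τ : ℝ) {w : ℕ → V}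
    (hw : ∀ ℓ < rk.s, ∀ ω, B (w (ℓ + 1)) ω = ∑ κ ∈ Finset.range (ℓ + 1),
      (rk.c ℓ κ * B (w κ) ω + τ * rk.d ℓ κ * H (w κ) ω)) :
    ∀ ℓ ≤ rk.s, w ℓ = aeval (τ • L) (rk.stagePoly ℓ) (w 0) := by
  intro ℓ
  induction ℓ using Nat.strong_induction_on with
  | _ ℓ ih =>
    intro hℓ
    match ℓ, ih, hℓ with
    | 0, _, _ => simp [RKMethod.stagePoly]
    | ℓ + 1, ih, hℓ =>
      have e : w (ℓ + 1) = ∑ κ ∈ Finset.range (ℓ + 1),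
          (rk.c ℓ κ • w κ + (τ * rk.d ℓ κ) • L (w κ)) := by
        by_contra hne
        have hlt := hpos _ (sub_ne_zero.mpr hne)
        have hz : ∀ ω, B (w (ℓ + 1) - ∑ κ ∈ Finset.range (ℓ + 1),
            (rk.c ℓ κ • w κ + (τ * rk.d ℓ κ) • L (w κ))) ω = 0 := by
          intro ω
          rw [map_sub, LinearMap.sub_apply, hw ℓ hℓ ω, map_sum, LinearMap.sum_apply, sub_eq_zero]
          refine Finset.sum_congr rfl fun κ _ => ?_
          simp [hL]
        exact hlt.ne' (hz _)
      rw [e, RKMethod.stagePoly, map_sum, LinearMap.sum_apply,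
        Finset.sum_range fun κ => rk.c ℓ κ • w κ + (τ * rk.d ℓ κ) • L (w κ)]
      refine Finset.sum_congr rfl fun κ _ => ?_
      rw [ih κ (by omega) (by omega)]
      simp [mul_smul, smul_comm τ]

/-- A symmetric positive definite form as an inner product. -/
@[reducible] def formCore (B : V →ₗ[ℝ] V →ₗ[ℝ] ℝ) (hsymm : ∀ v w, B v w = B w v)
    (hpos : ∀ v, v ≠ 0 → 0 < B v v) : InnerProductSpace.Core ℝ V where
  inner v w := B v w
  conj_inner_symm v w := hsymm w v
  re_inner_nonneg v := by
    by_cases h : v = 0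
    · simp [h]
    · exact (hpos v h).le
  add_left u v w := by simp
  smul_left u v r := by simp
  definite v h := by
    by_contra hne
    exact (hpos v hne).ne' h

theorem exists_bound_of_form [FiniteDimensional ℝ V] {B : V →ₗ[ℝ] V →ₗ[ℝ] ℝ}
    (hsymm : ∀ v w, B v w = B w v) (hpos : ∀ v, v ≠ 0 → 0 < B v v) (G : V →ₗ[ℝ] V →ₗ[ℝ] ℝ) :
    ∃ c : ℝ, 0 ≤ c ∧ ∀ v w, |G v w| ≤ c * √(B v v) * √(B w w) := by
  let c : InnerProductSpace.Core ℝ V := formCore B hsymm hpos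
  let _ : NormedAddCommGroup V := c.toNormedAddCommGroup
  let _ : InnerProductSpace ℝ V := InnerProductSpace.ofCore c.toCore
  exact exists_bilin_norm_bound G

/-- Definiteness makes `B` injective into the dual, hence bijective by dimension. Symmetry is not
needed. -/
theorem exists_operator [FiniteDimensional ℝ V] {B : V →ₗ[ℝ] V →ₗ[ℝ] ℝ}
    (hpos : ∀ v, v ≠ 0 → 0 < B v v) (H : V →ₗ[ℝ] V →ₗ[ℝ] ℝ) :
    ∃ L : V →ₗ[ℝ] V, ∀ v w, B (L v) w = H v w := by
  have hinj : Function.Injective B := by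
    rw [← LinearMap.ker_eq_bot, LinearMap.ker_eq_bot']
    intro v hv
    by_contra hne
    exact (hpos v hne).ne' (by simp [hv])
  have hfr : Module.finrank ℝ V = Module.finrank ℝ (Module.Dual ℝ V) :=
    (Subspace.dual_finrank_eq).symm
  let e := LinearEquiv.ofInjectiveOfFinrankEq B hinj hfr
  refine ⟨e.symm.toLinearMap ∘ₗ H, fun v w => ?_⟩
  have : B (e.symm (H v)) = H v := e.apply_symm_apply (H v)
  simp [this]

/-- Energy bounds for a Galerkin Runge--Kutta step with a dissipative form `H` bounded by `Λ`. -/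
theorem galerkin_energy_le [FiniteDimensional ℝ V] {B H : V →ₗ[ℝ] V →ₗ[ℝ] ℝ}
    (hsymm : ∀ v w, B v w = B w v) (hpos : ∀ v, v ≠ 0 → 0 < B v v)
    (hneg : ∀ v, H v v ≤ 0) {Λ : ℝ}
    (hH : ∀ v w, |H v w| ≤ Λ * √(B v v) * √(B w w))
    (rk : RKMethod) {τ θ : ℝ} (hτ : 0 ≤ τ) (hθ₀ : 0 ≤ θ) (hθ : τ * Λ ≤ θ) (hθ₁ : θ ≤ 1) {w : ℕ → V}
    (hw : ∀ ℓ < rk.s, ∀ ω, B (w (ℓ + 1)) ω = ∑ κ ∈ Finset.range (ℓ + 1),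
      (rk.c ℓ κ * B (w κ) ω + τ * rk.d ℓ κ * H (w κ) ω)) :
    ((rk.stagePoly rk.s).coeff 0 = 1 → (rk.stagePoly rk.s).coeff 1 = 1 →
      B (w rk.s) (w rk.s) ≤ (1 + growthConst (rk.stagePoly rk.s) * θ ^ 2) * B (w 0) (w 0)) ∧
    (rk.stagePoly rk.s = 1 + X + X ^ 2 → B (w rk.s) (w rk.s) ≤ B (w 0) (w 0)) := by
  obtain ⟨L, hL⟩ := exists_operator hpos H
  have hws := eq_stagePoly_of_galerkin hpos hL rk τ hw rk.s le_rfl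
  let c : InnerProductSpace.Core ℝ V := formCore B hsymm hpos
  let _ : NormedAddCommGroup V := c.toNormedAddCommGroup
  let _ : InnerProductSpace ℝ V := InnerProductSpace.ofCore c.toCore
  have hin : ∀ v w : V, inner ℝ v w = B v w := fun _ _ => rfl
  have hnorm : ∀ v : V, ‖v‖ ^ 2 = B v v := fun v => by
    rw [← real_inner_self_eq_norm_sq, hin]
  have hsqrt : ∀ v : V, √(B v v) = ‖v‖ := fun v => by
    rw [← hnorm, Real.sqrt_sq (norm_nonneg _)]
  have hdiss : ∀ v : V, inner ℝ ((τ • L) v) v ≤ 0 := fun v => by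
    rw [hin, LinearMap.smul_apply, map_smul, LinearMap.smul_apply, hL, smul_eq_mul]
    exact mul_nonpos_of_nonneg_of_nonpos hτ (hneg v)
  have hbd : ∀ v : V, ‖(τ • L) v‖ ≤ θ * ‖v‖ := by
    intro v
    by_cases h0 : ‖(τ • L) v‖ = 0
    · rw [h0]
      positivity
    · have hp : 0 < ‖(τ • L) v‖ := lt_of_le_of_ne (norm_nonneg _) (Ne.symm h0)
      -- The form bound tested with `z = (τ • L) v`, after which one factor cancels.
      have h2 : ‖(τ • L) v‖ * ‖(τ • L) v‖ ≤ θ * ‖v‖ * ‖(τ • L) v‖ := by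
        rw [← pow_two, hnorm]
        have hB : ∀ z, B ((τ • L) v) z = τ * H v z := fun z => by
          rw [LinearMap.smul_apply, map_smul, LinearMap.smul_apply, hL, smul_eq_mul]
        calc B ((τ • L) v) ((τ • L) v) = τ * H v ((τ • L) v) := hB _
          _ ≤ τ * (Λ * ‖v‖ * ‖(τ • L) v‖) := by
              refine mul_le_mul_of_nonneg_left ((le_abs_self _).trans ?_) hτ
              have := hH v ((τ • L) v)
              rwa [hsqrt, hsqrt] at this
          _ = τ * Λ * ‖v‖ * ‖(τ • L) v‖ := by ring
          _ ≤ θ * ‖v‖ * ‖(τ • L) v‖ := by gcongr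
      exact le_of_mul_le_mul_right h2 hp
  refine ⟨fun h0 h1 => ?_, fun hR => ?_⟩
  · rw [← hnorm, ← hnorm, hws]
    exact norm_sq_aeval_apply_le hdiss hθ₀ hθ₁ hbd h0 h1 (w 0)
  · have hb := fun v => (hbd v).trans (mul_le_of_le_one_left (norm_nonneg v) hθ₁)
    rw [← hnorm, ← hnorm, hws, hR]
    have := norm_sq_quadratic_apply_le hdiss hb (w 0)
    simpa [pow_two, add_assoc] using this

end Galerkin

/-! ### Legendre polynomials on the unit interval. -/

section UnitInterval

/-- The integral of a polynomial over `[0, 1]`. -/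
def unitInt : ℝ[X] →ₗ[ℝ] ℝ where
  toFun p := ∫ x in (0 : ℝ)..1, p.eval x
  map_add' p q := by
    simp only [eval_add]
    exact intervalIntegral.integral_add (p.continuous.intervalIntegrable _ _)
      (q.continuous.intervalIntegrable _ _)
  map_smul' c p := by simp

lemma unitInt_apply (p : ℝ[X]) : unitInt p = ∫ x in (0 : ℝ)..1, p.eval x := rfl

lemma integral_eval_derivative (p : ℝ[X]) (a b : ℝ) :
    ∫ x in a..b, (derivative p).eval x = p.eval b - p.eval a :=
  intervalIntegral.integral_eq_sub_of_hasDerivAt (fun x _ => p.hasDerivAt x)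
    ((derivative p).continuous.intervalIntegrable _ _)

lemma unitInt_derivative (p : ℝ[X]) : unitInt (derivative p) = p.eval 1 - p.eval 0 :=
  integral_eval_derivative p 0 1

lemma unitInt_derivative_mul (p q : ℝ[X]) :
    unitInt (derivative p * q) =
      p.eval 1 * q.eval 1 - p.eval 0 * q.eval 0 - unitInt (p * derivative q) := by
  have := unitInt_derivative (p * q)
  rw [derivative_mul, map_add, eval_mul, eval_mul] at this
  linarith

lemma unitInt_mul_self_nonneg (p : ℝ[X]) : 0 ≤ unitInt (p * p) :=
  intervalIntegral.integral_nonneg zero_le_one fun x _ => by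
    rw [eval_mul]
    exact mul_self_nonneg _

lemma unitInt_mul_self_pos {p : ℝ[X]} (hp : p ≠ 0) : 0 < unitInt (p * p) := by
  refine lt_of_le_of_ne (unitInt_mul_self_nonneg p) fun h => hp ?_
  have hc : Continuous fun x => (p * p).eval x := (p * p).continuous
  have h0 : ∀ x ∈ Set.Ioo (0 : ℝ) 1, p.eval x = 0 := by
    intro x hx
    by_contra hne
    refine absurd h (ne_of_lt ?_)
    refine intervalIntegral.integral_pos zero_lt_one hc.continuousOn (fun y _ => ?_)
      ⟨x, Set.Ioo_subset_Icc_self hx, ?_⟩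
    · rw [eval_mul]
      exact mul_self_nonneg _
    · rw [eval_mul]
      exact mul_self_pos.mpr hne
  exact eq_zero_of_infinite_isRoot p ((Set.Ioo_infinite zero_lt_one).mono h0)

/-- The Beta integral. Integration by parts trades a factor `1 - X` for a factor `X`, hence the
induction on `b` with `a` free. -/
lemma unitInt_X_pow_mul_one_sub_X_pow (b : ℕ) : ∀ a : ℕ,
    unitInt (X ^ a * (1 - X) ^ b) = a.factorial * b.factorial / (a + b + 1).factorial := by
  induction b with
  | zero =>
    intro a
    simp only [unitInt_apply, pow_zero, mul_one, eval_pow, eval_X, integral_pow, Nat.factorial]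
    push_cast
    have : (a.factorial : ℝ) ≠ 0 := by positivity
    field_simp
    simp
  | succ b ih =>
    intro a
    have h := unitInt_derivative_mul (X ^ (a + 1)) ((1 - X) ^ (b + 1))
    have e1 : derivative (X ^ (a + 1) : ℝ[X]) * (1 - X) ^ (b + 1) =
        ((a : ℝ) + 1) • (X ^ a * (1 - X) ^ (b + 1)) := by
      rw [derivative_X_pow, smul_eq_C_mul]
      simp
      ring
    have e2 : (X ^ (a + 1) : ℝ[X]) * derivative ((1 - X) ^ (b + 1)) =
        (-((b : ℝ) + 1)) • (X ^ (a + 1) * (1 - X) ^ b) := by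
      rw [derivative_pow, smul_eq_C_mul]
      simp
      ring
    rw [e1, e2, map_smul, map_smul, ih] at h
    simp only [eval_pow, eval_X, eval_sub, eval_one, smul_eq_mul, one_pow, sub_self, ne_eq,
      Nat.add_eq_zero_iff, one_ne_zero, and_false, not_false_eq_true, zero_pow] at h
    have ha : (a : ℝ) + 1 ≠ 0 := by positivity
    rw [show a + 1 + b + 1 = a + (b + 1) + 1 by ring] at h
    have hf : ((a + (b + 1) + 1).factorial : ℝ) ≠ 0 := by positivity
    rw [Nat.factorial_succ a, Nat.cast_mul] at h
    rw [Nat.factorial_succ b, Nat.cast_mul]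
    push_cast at h ⊢
    field_simp at h ⊢
    have := mul_left_cancel₀ ha (b := unitInt (X ^ a * (1 - X) ^ (b + 1)) *
      ((a + (b + 1) + 1).factorial : ℝ)) (c := a.factorial * (b + 1) * b.factorial) (by linarith)
    linarith

/-- The Legendre polynomial on `[0, 1]`, equal to `1` at `1`. -/
def unitLegendre (n : ℕ) : ℝ[X] :=
  C ((-1 : ℝ) ^ n) * (shiftedLegendre n).map (Int.castRingHom ℝ)

/-- Rodrigues' formula. -/
lemma factorial_mul_unitLegendre (n : ℕ) :
    C (n.factorial : ℝ) * unitLegendre n =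
      C ((-1 : ℝ) ^ n) * derivative^[n] (X ^ n * (1 - X) ^ n) := by
  have h := congrArg (map (Int.castRingHom ℝ)) (factorial_mul_shiftedLegendre_eq n)
  rw [← iterate_derivative_map] at h
  simp only [Polynomial.map_mul, Polynomial.map_pow, Polynomial.map_sub, map_X, Polynomial.map_one,
    Polynomial.map_natCast] at h
  rw [← h, unitLegendre, map_natCast]
  ring

lemma coeff_unitLegendre (n : ℕ) : (unitLegendre n).coeff n = n.centralBinom := by
  rw [unitLegendre, coeff_C_mul, coeff_map, coeff_shiftedLegendre, Nat.centralBinom, two_mul]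
  simp [← mul_assoc, ← mul_pow]

lemma degree_unitLegendre_le (n : ℕ) : (unitLegendre n).degree ≤ n := by
  rw [unitLegendre, ← smul_eq_C_mul]
  exact (degree_smul_le _ _).trans (degree_map_le.trans (degree_shiftedLegendre n).le)

lemma eval_iterate_derivative_eq_zero (n j : ℕ) (hj : j < n) :
    (derivative^[j] (X ^ n * (1 - X) ^ n : ℝ[X])).eval 0 = 0 ∧
    (derivative^[j] (X ^ n * (1 - X) ^ n : ℝ[X])).eval 1 = 0 := by
  constructor
  · obtain ⟨r, hr⟩ := pow_sub_dvd_iterate_derivative_of_pow_dvd j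
      (Dvd.intro _ rfl : (X : ℝ[X]) ^ n ∣ X ^ n * (1 - X) ^ n)
    simp [hr, (Nat.sub_pos_of_lt hj).ne']
  · obtain ⟨r, hr⟩ := pow_sub_dvd_iterate_derivative_of_pow_dvd j
      (Dvd.intro_left _ rfl : (1 - X : ℝ[X]) ^ n ∣ X ^ n * (1 - X) ^ n)
    simp [hr, (Nat.sub_pos_of_lt hj).ne']

/-- Repeated integration by parts; all boundary terms vanish because `X ^ n * (1 - X) ^ n` has zeros
of order `n` at both ends. -/
lemma unitInt_iterate_derivative_mul (n : ℕ) (q : ℝ[X]) : ∀ j ≤ n,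
    unitInt (derivative^[n] (X ^ n * (1 - X) ^ n) * q) =
      (-1) ^ j * unitInt (derivative^[n - j] (X ^ n * (1 - X) ^ n) * derivative^[j] q) := by
  intro j
  induction j with
  | zero => simp
  | succ j ih =>
    intro hj
    obtain ⟨h0, h1⟩ := eval_iterate_derivative_eq_zero n (n - (j + 1)) (by omega)
    rw [ih (by omega), show n - j = (n - (j + 1)) + 1 by omega, Function.iterate_succ_apply',
      unitInt_derivative_mul, h0, h1, Function.iterate_succ_apply']
    ring

lemma iterate_derivative_of_degree_le {q : ℝ[X]} {n : ℕ} (hq : q.degree ≤ n) :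
    derivative^[n] q = C (n.factorial * q.coeff n) := by
  ext m
  rw [coeff_iterate_derivative, coeff_C]
  split_ifs with h
  · subst h
    simp [Nat.descFactorial_self]
  · rw [coeff_eq_zero_of_degree_lt (hq.trans_lt (by exact_mod_cast (by omega : n < m + n))),
      smul_zero]

/-- Orthogonality and normalization of the Legendre polynomials. -/
lemma unitInt_unitLegendre_mul {q : ℝ[X]} {n : ℕ} (hq : q.degree ≤ n) :
    unitInt (unitLegendre n * q) = q.coeff n / ((2 * n + 1) * n.centralBinom) := by
  have h1 : (n.factorial : ℝ) * unitInt (unitLegendre n * q) =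
      n.factorial * q.coeff n * (n.factorial * n.factorial / (n + n + 1).factorial) := by
    rw [← smul_eq_mul, ← map_smul, smul_eq_C_mul, ← mul_assoc, factorial_mul_unitLegendre,
      mul_assoc, ← smul_eq_C_mul, map_smul, unitInt_iterate_derivative_mul n q n le_rfl,
      iterate_derivative_of_degree_le hq, mul_comm _ (C _), ← smul_eq_C_mul, map_smul, Nat.sub_self,
      Function.iterate_zero_apply, unitInt_X_pow_mul_one_sub_X_pow, smul_eq_mul, smul_eq_mul,
      ← mul_assoc, ← mul_pow]
    simp
  have h2 : ((n + n + 1).factorial : ℝ) =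
      (2 * n + 1) * n.centralBinom * (n.factorial * n.factorial) := by
    have := Nat.choose_mul_factorial_mul_factorial (show n ≤ 2 * n by omega)
    rw [show 2 * n - n = n by omega] at this
    rw [Nat.factorial_succ, Nat.centralBinom, ← two_mul, ← this]
    push_cast
    ring
  have hf : (n.factorial : ℝ) ≠ 0 := by positivity
  have hc : (n.centralBinom : ℝ) ≠ 0 := by exact_mod_cast n.centralBinom_ne_zero
  have h3 : (2 * (n : ℝ) + 1) ≠ 0 := by positivity
  rw [h2] at h1
  have := mul_left_cancel₀ hf (h1.trans (mul_assoc _ _ _))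
  rw [this]
  field_simp

end UnitInterval

/-! ### Symmetry, coercivity and inverse estimates on the unit cell. -/

section UnitCell

lemma exists_antiderivative {k : ℕ} {v : ℝ[X]} (hv : v.degree ≤ k) :
    ∃ V : ℝ[X], derivative V = v ∧ V.eval 0 = 0 ∧ V.natDegree ≤ k + 1 := by
  have hv' : v.natDegree ≤ k := natDegree_le_of_degree_le hv
  refine ⟨∑ i ∈ Finset.range (k + 1), C (v.coeff i / (i + 1)) * X ^ (i + 1), ?_, ?_, ?_⟩
  · rw [derivative_sum]
    conv_rhs => rw [v.as_sum_range_C_mul_X_pow' (Nat.lt_succ_of_le hv')]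
    refine Finset.sum_congr rfl fun i _ => ?_
    rw [derivative_C_mul_X_pow]
    have : (i : ℝ) + 1 ≠ 0 := by positivity
    push_cast
    rw [div_mul_cancel₀ _ this]
  · simp [eval_finsetSum]
  · refine natDegree_sum_le_of_forall_le _ _ fun i hi => ?_
    refine (natDegree_C_mul_X_pow_le _ _).trans ?_
    have := Finset.mem_range.mp hi
    omega

/-- Subtracting the leading monomial leaves a polynomial that `E` kills. -/
lemma functional_eq_coeff_mul {E : ℝ[X] →ₗ[ℝ] ℝ} {n : ℕ}
    (hE : ∀ p : ℝ[X], p.degree < n → E p = 0) {p : ℝ[X]} (hp : p.natDegree ≤ n) :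
    E p = p.coeff n * E (X ^ n) := by
  have h := hE (p - C (p.coeff n) * X ^ n) (by
    rw [degree_lt_iff_coeff_zero]
    intro m hm
    rw [coeff_sub, coeff_C_mul, coeff_X_pow]
    split_ifs with h
    · subst h
      ring
    · rw [coeff_eq_zero_of_natDegree_lt (by omega)]
      ring)
  rw [map_sub, ← smul_eq_C_mul, map_smul, smul_eq_mul] at h
  linarith

/-- With `k = j + 1`, the degree `2k` coefficient of `V w'` is `v_k / (k + 1)` times `k w_k`, where
`v = V'`. -/
lemma functional_antiderivative_mul_derivative {E : ℝ[X] →ₗ[ℝ] ℝ} {j : ℕ}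
    (hE : ∀ p : ℝ[X], p.degree < ((2 * (j + 1) : ℕ) : WithBot ℕ) → E p = 0) {V w : ℝ[X]}
    (hV : V.natDegree ≤ j + 2) (hw : w.natDegree ≤ j + 1) :
    E (V * derivative w) = (derivative V).coeff (j + 1) * w.coeff (j + 1) *
      ((j + 1) / (j + 2)) * E (X ^ (2 * (j + 1))) := by
  have hw' : (derivative w).natDegree ≤ j := (natDegree_derivative_le w).trans (by omega)
  have hd : (V * derivative w).natDegree ≤ 2 * (j + 1) :=
    natDegree_mul_le.trans (by omega)
  rw [functional_eq_coeff_mul hE hd, show 2 * (j + 1) = (j + 2) + j by ring,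
    coeff_mul_add_eq_of_natDegree_le hV hw', coeff_derivative, coeff_derivative]
  have : (j : ℝ) + 2 ≠ 0 := by positivity
  push_cast
  field_simp
  ring

/-- Bessel's inequality for the single mode `unitLegendre n`: the left side is the squared norm of
the projection of `v` onto it. -/
lemma coeff_sq_le_unitInt {v : ℝ[X]} {n : ℕ} (hv : v.degree ≤ n) :
    v.coeff n ^ 2 / ((2 * n + 1) * (n.centralBinom : ℝ) ^ 2) ≤ unitInt (v * v) := by
  set t : ℝ := v.coeff n / n.centralBinom with ht
  have hc : (n.centralBinom : ℝ) ≠ 0 := by exact_mod_cast n.centralBinom_ne_zero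
  have hn : (2 * (n : ℝ) + 1) ≠ 0 := by positivity
  have h := unitInt_mul_self_nonneg (v - C t * unitLegendre n)
  have e : (v - C t * unitLegendre n) * (v - C t * unitLegendre n) =
      v * v - (2 * t) • (unitLegendre n * v) + t ^ 2 • (unitLegendre n * unitLegendre n) := by
    simp only [smul_eq_C_mul, C_mul, C_pow, map_ofNat]
    ring
  rw [e, map_add, map_sub, map_smul, map_smul, unitInt_unitLegendre_mul hv,
    unitInt_unitLegendre_mul (degree_unitLegendre_le n), coeff_unitLegendre, ht] at h
  simp only [smul_eq_mul] at h
  have e2 : v.coeff n ^ 2 / ((2 * n + 1) * (n.centralBinom : ℝ) ^ 2) =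
      2 * (v.coeff n / n.centralBinom) * (v.coeff n / ((2 * n + 1) * n.centralBinom)) -
      (v.coeff n / n.centralBinom) ^ 2 * (n.centralBinom / ((2 * n + 1) * n.centralBinom)) := by
    field_simp
    ring
  linarith

/-- The coercivity constant of the energy norm. -/
def coercivityConst (k : ℕ) (δ : ℝ) : ℝ := if k = 0 then 1 else min 1 ((2 * k - 1) * δ)

lemma coercivityConst_pos (k : ℕ) {δ : ℝ} (hδ : 0 < δ) : 0 < coercivityConst k δ := by
  unfold coercivityConst
  split_ifs with h
  · exact one_pos
  · have : (1 : ℝ) ≤ k := by exact_mod_cast Nat.one_le_iff_ne_zero.mpr h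
    exact lt_min one_pos (mul_pos (by linarith) hδ)

/-- Coercivity of the energy norm on the unit cell; `E` is the quadrature error. -/
theorem coercivity_unit_cell {k : ℕ} {δ : ℝ} {E : ℝ[X] →ₗ[ℝ] ℝ}
    (hE : ∀ p : ℝ[X], p.degree < ((2 * k : ℕ) : WithBot ℕ) → E p = 0)
    (hm : 1 ≤ k → δ ≤ 1 / (2 * (k : ℝ) - 1) + E (unitLegendre (k + 1) * unitLegendre (k - 1)))
    {V : ℝ[X]} (hV : V.natDegree ≤ k + 1) (hv : (derivative V).degree ≤ k) :
    coercivityConst k δ * unitInt (derivative V * derivative V) ≤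
      unitInt (derivative V * derivative V) + E (V * derivative (derivative V)) := by
  obtain _ | j := k
  -- For `k = 0` exactness says nothing, but the correction `E (V v')` vanishes because `v` is
  -- constant.
  · have : derivative (derivative V) = 0 :=
      derivative_of_natDegree_zero (Nat.le_zero.mp (natDegree_le_of_degree_le hv))
    simp [coercivityConst, this]
  rw [coercivityConst, if_neg (Nat.succ_ne_zero j)]
  have hn : (derivative V).natDegree ≤ j + 1 := natDegree_le_of_degree_le hv
  rw [functional_antiderivative_mul_derivative hE hV hn]
  have hL : (unitLegendre (j + 2) * unitLegendre j).natDegree ≤ 2 * (j + 1) := by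
    refine natDegree_mul_le.trans ?_
    have h1 := natDegree_le_of_degree_le (degree_unitLegendre_le (j + 2))
    have h2 := natDegree_le_of_degree_le (degree_unitLegendre_le j)
    omega
  have hLE : E (unitLegendre (j + 2) * unitLegendre j) =
      (j + 2).centralBinom * j.centralBinom * E (X ^ (2 * (j + 1))) := by
    rw [functional_eq_coeff_mul hE hL, show 2 * (j + 1) = (j + 2) + j by ring,
      coeff_mul_add_eq_of_natDegree_le (natDegree_le_of_degree_le (degree_unitLegendre_le _))
        (natDegree_le_of_degree_le (degree_unitLegendre_le _)),
      coeff_unitLegendre, coeff_unitLegendre]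
  have hm := hm (by omega)
  rw [show j + 1 - 1 = j by omega, show j + 1 + 1 = j + 2 by ring, hLE] at hm
  have hP := coeff_sq_le_unitInt hv
  set a := (derivative V).coeff (j + 1)
  set I := unitInt (derivative V * derivative V)
  set e := E (X ^ (2 * (j + 1)))
  have b1 : ((j : ℝ) + 1) * (j + 1).centralBinom = 2 * (2 * j + 1) * j.centralBinom := by
    exact_mod_cast Nat.succ_mul_centralBinom_succ j
  have b2 : ((j : ℝ) + 2) * (j + 2).centralBinom = 2 * (2 * j + 3) * (j + 1).centralBinom := by
    have := Nat.succ_mul_centralBinom_succ (j + 1)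
    rw [show 2 * (j + 1) + 1 = 2 * j + 3 by ring] at this
    exact_mod_cast this
  have hc0 : (0 : ℝ) < (j + 1).centralBinom := by exact_mod_cast (j + 1).centralBinom_pos
  set c0 : ℝ := (j.centralBinom : ℝ)
  set c1 : ℝ := ((j + 1).centralBinom : ℝ)
  set c2 : ℝ := ((j + 2).centralBinom : ℝ)
  -- `P` is the squared norm of the top Legendre component of `v = V'`.
  set P := a ^ 2 / ((2 * ((j + 1 : ℕ) : ℝ) + 1) * c1 ^ 2) with hPdef
  have hc1 : c1 ≠ 0 := hc0.ne'
  have h0 : c0 = (j + 1) * c1 / (2 * (2 * j + 1)) := by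
    field_simp
    linarith
  have h2 : c2 = 2 * (2 * j + 3) * c1 / (j + 2) := by
    field_simp
    linarith
  -- The central binomial recurrences express the correction as `P` times `2k - 1` times the error
  -- of `L_{k+1} L_{k-1}`, the quantity in the margin condition.
  have hPe : a * a * ((j + 1) / (j + 2)) * e = P * ((2 * j + 1) * (c2 * c0 * e)) := by
    rw [hPdef, h0, h2]
    push_cast
    field_simp
    ring
  have hP0 : 0 ≤ P := by positivity
  have hj : (2 * ((j + 1 : ℕ) : ℝ) - 1) = 2 * j + 1 := by
    push_cast
    ring
  rw [hPe, hj]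
  rw [hj] at hm
  have hj0 : (0 : ℝ) < 2 * j + 1 := by positivity
  have hm2 : (2 * j + 1) * δ - 1 ≤ (2 * j + 1) * (c2 * c0 * e) := by
    have := mul_le_mul_of_nonneg_left hm hj0.le
    rw [mul_add, mul_one_div_cancel hj0.ne'] at this
    linarith
  -- Split `I = (I - P) + P`: the lower modes keep the factor `1`, the top mode keeps at least `(2k
  -- - 1) δ`.
  have h3 := mul_le_mul_of_nonneg_left hm2 hP0
  have h4 := mul_le_mul_of_nonneg_right (min_le_left 1 ((2 * (j : ℝ) + 1) * δ)) (sub_nonneg.mpr hP)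
  have h5 := mul_le_mul_of_nonneg_right (min_le_right 1 ((2 * (j : ℝ) + 1) * δ)) hP0
  linarith

lemma functional_symm {k : ℕ} {E : ℝ[X] →ₗ[ℝ] ℝ}
    (hE : ∀ p : ℝ[X], p.degree < ((2 * k : ℕ) : WithBot ℕ) → E p = 0) {V W : ℝ[X]}
    (hV : V.natDegree ≤ k + 1) (hW : W.natDegree ≤ k + 1) (hv : (derivative V).degree ≤ k)
    (hw : (derivative W).degree ≤ k) :
    E (V * derivative (derivative W)) = E (W * derivative (derivative V)) := by
  have hv := natDegree_le_of_degree_le hv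
  have hw := natDegree_le_of_degree_le hw
  obtain _ | j := k
  · rw [derivative_of_natDegree_zero (Nat.le_zero.mp hv),
      derivative_of_natDegree_zero (Nat.le_zero.mp hw), mul_zero, mul_zero]
  · rw [functional_antiderivative_mul_derivative hE hV hw,
      functional_antiderivative_mul_derivative hE hW hv]
    ring

lemma finiteDimensional_degreeLE (k : ℕ) : FiniteDimensional ℝ (degreeLE ℝ (k : WithBot ℕ)) := by
  rw [degreeLE_eq_span_X_pow]
  exact FiniteDimensional.span_finset ℝ _

/-- The `L²` inner product on polynomials of degree `≤ k` on the unit cell. -/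
def unitForm (k : ℕ) :
    degreeLE ℝ (k : WithBot ℕ) →ₗ[ℝ] degreeLE ℝ (k : WithBot ℕ) →ₗ[ℝ] ℝ :=
  LinearMap.mk₂ ℝ (fun p q => unitInt ((p : ℝ[X]) * q))
    (fun p q r => by simp [add_mul]) (fun c p q => by simp)
    (fun p q r => by simp [mul_add]) (fun c p q => by simp)

/-- Inverse estimates: every bilinear form on polynomials of degree `≤ k` is bounded in `L²`. -/
theorem exists_bilin_bound {k : ℕ}
    (B : degreeLE ℝ (k : WithBot ℕ) →ₗ[ℝ] degreeLE ℝ (k : WithBot ℕ) →ₗ[ℝ] ℝ) :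
    ∃ c : ℝ, 0 ≤ c ∧ ∀ p q : degreeLE ℝ (k : WithBot ℕ),
      |B p q| ≤ c * √(unitInt ((p : ℝ[X]) * p)) * √(unitInt ((q : ℝ[X]) * q)) := by
  have := finiteDimensional_degreeLE k
  exact exists_bound_of_form (B := unitForm k) (fun p q => by simp [unitForm, mul_comm])
    (fun p hp => unitInt_mul_self_pos (by simpa using hp)) B

end UnitCell

/-! ### Discrete summation by parts. -/

/-- Summation by parts. -/
lemma sum_sub_mul_eq {k : ℕ} (F : Fin (k + 2) → ℝ) (m : Fin (k + 1) → ℝ) (g : Fin k → ℝ)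
    (hm : ∀ j : Fin k, m j.succ = m j.castSucc + g j) :
    ∑ j, (F j.succ - F j.castSucc) * m j =
      F (Fin.last _) * m (Fin.last _) - F 0 * m 0 - ∑ j : Fin k, F j.succ.castSucc * g j := by
  induction k with
  | zero => simp [sub_mul]
  | succ k ih =>
    have h := ih (fun j => F j.castSucc) (fun j => m j.castSucc) (fun j => g j.castSucc)
      (fun j => hm j.castSucc)
    have hl := hm (Fin.last k)
    rw [Fin.succ_last] at hl
    rw [Fin.sum_univ_castSucc, Fin.sum_univ_castSucc (f := fun j : Fin (k + 1) => _ * g j)]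
    simp only [Fin.succ_castSucc, Fin.succ_last, Fin.castSucc_zero] at h ⊢
    rw [h, hl]
    ring

lemma last_eq_add_sum {k : ℕ} (m : Fin (k + 1) → ℝ) (g : Fin k → ℝ)
    (hm : ∀ j : Fin k, m j.succ = m j.castSucc + g j) : m (Fin.last k) = m 0 + ∑ j, g j := by
  induction k with
  | zero => simp
  | succ k ih =>
    have h := ih (fun j => m j.castSucc) (fun j => g j.castSucc) (fun j => hm j.castSucc)
    rw [Fin.sum_univ_castSucc, ← Fin.succ_last, hm, h, Fin.castSucc_zero]
    ring

/-! ### Transport between a mesh cell and the unit cell. -/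

namespace SVMesh

variable {k : ℕ}

section Cell

variable (M : SVMesh k) (i : Fin (M.m + 1))

lemma width_pos : 0 < M.width i :=
  sub_pos.mpr (M.node_strictMono i.castSucc_lt_succ)

lemma width_le_size : M.width i ≤ M.size :=
  le_ciSup (Set.finite_range M.width).bddAbove i

lemma size_pos : 0 < M.size := (M.width_pos 0).trans_le (M.width_le_size 0)

/-- The affine map from the unit cell to cell `i`. -/
def toCell : ℝ[X] := C (M.width i) * X + C (M.left i)

/-- The affine map from cell `i` to the unit cell. -/
def ofCell : ℝ[X] := C (M.width i)⁻¹ * (X - C (M.left i))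

lemma toCell_comp_ofCell : (M.toCell i).comp (M.ofCell i) = X := by
  have h : C (M.width i) * C (M.width i)⁻¹ = (1 : ℝ[X]) := by
    rw [← C_mul, mul_inv_cancel₀ (M.width_pos i).ne', C_1]
  simp [toCell, ofCell, ← mul_assoc, h]

lemma ofCell_comp_toCell : (M.ofCell i).comp (M.toCell i) = X := by
  have h : C (M.width i)⁻¹ * C (M.width i) = (1 : ℝ[X]) := by
    rw [← C_mul, inv_mul_cancel₀ (M.width_pos i).ne', C_1]
  simp [toCell, ofCell, ← mul_assoc, h]

lemma comp_toCell_comp_ofCell (p : ℝ[X]) : (p.comp (M.toCell i)).comp (M.ofCell i) = p := by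
  rw [comp_assoc, toCell_comp_ofCell, comp_X]

lemma comp_ofCell_comp_toCell (p : ℝ[X]) : (p.comp (M.ofCell i)).comp (M.toCell i) = p := by
  rw [comp_assoc, ofCell_comp_toCell, comp_X]

lemma natDegree_ofCell_le : (M.ofCell i).natDegree ≤ 1 :=
  (natDegree_C_mul_le _ _).trans (natDegree_X_sub_C _).le

lemma natDegree_toCell_le : (M.toCell i).natDegree ≤ 1 := natDegree_linear_le

lemma eval_toCell_zero : (M.toCell i).eval 0 = M.left i := by simp [toCell]

lemma eval_toCell_one : (M.toCell i).eval 1 = M.right i := by simp [toCell, width]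

lemma eval_ofCell_left : (M.ofCell i).eval (M.left i) = 0 := by simp [ofCell]

lemma eval_ofCell_right : (M.ofCell i).eval (M.right i) = 1 := by
  have := (M.width_pos i).ne'
  rw [width] at this
  simp [ofCell, width, this]

lemma derivative_comp_ofCell (p : ℝ[X]) :
    derivative (p.comp (M.ofCell i)) = C (M.width i)⁻¹ * (derivative p).comp (M.ofCell i) := by
  rw [derivative_comp]
  simp [ofCell, mul_comm]

lemma degree_comp_le {p q : ℝ[X]} {n : ℕ} (hq : q.natDegree ≤ 1) (hp : p.degree ≤ n) :
    (p.comp q).degree ≤ n := by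
  rw [← natDegree_le_iff_degree_le] at hp ⊢
  calc (p.comp q).natDegree ≤ p.natDegree * q.natDegree := natDegree_comp_le
    _ ≤ n * 1 := Nat.mul_le_mul hp hq
    _ = n := mul_one n

lemma integral_cell (p : ℝ[X]) :
    ∫ x in (M.left i)..(M.right i), p.eval x = M.width i * unitInt (p.comp (M.toCell i)) := by
  have h := intervalIntegral.integral_comp_mul_add (a := 0) (b := 1) (fun x => p.eval x)
    (M.width_pos i).ne' (M.left i)
  have e : M.width i * 1 + M.left i = M.right i := by simp [width]
  rw [mul_zero, zero_add, e, smul_eq_mul] at h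
  rw [unitInt_apply]
  simp only [toCell, eval_comp, eval_add, eval_mul, eval_C, eval_X]
  rw [h, mul_inv_cancel_left₀ (M.width_pos i).ne']

/-- Pull-back of a polynomial of degree `≤ k` from cell `i` to the unit cell. -/
def hat : degreeLE ℝ (k : WithBot ℕ) →ₗ[ℝ] degreeLE ℝ (k : WithBot ℕ) where
  toFun p := ⟨(p : ℝ[X]).comp (M.toCell i), mem_degreeLE.mpr
    (degree_comp_le (M.natDegree_toCell_le i) (mem_degreeLE.mp p.2))⟩
  map_add' p q := by ext1; simp
  map_smul' c p := by ext1; simp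

lemma coe_hat (p : degreeLE ℝ (k : WithBot ℕ)) :
    (M.hat i p : ℝ[X]) = (p : ℝ[X]).comp (M.toCell i) := rfl

lemma hat_comp_ofCell (p : degreeLE ℝ (k : WithBot ℕ)) :
    (M.hat i p : ℝ[X]).comp (M.ofCell i) = p := M.comp_toCell_comp_ofCell i p

lemma eval_hat_zero (p : degreeLE ℝ (k : WithBot ℕ)) :
    (M.hat i p : ℝ[X]).eval 0 = (p : ℝ[X]).eval (M.left i) := by
  rw [coe_hat, eval_comp, eval_toCell_zero]

lemma eval_hat_one (p : degreeLE ℝ (k : WithBot ℕ)) :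
    (M.hat i p : ℝ[X]).eval 1 = (p : ℝ[X]).eval (M.right i) := by
  rw [coe_hat, eval_comp, eval_toCell_one]

lemma derivative_eq_hat (p : degreeLE ℝ (k : WithBot ℕ)) :
    derivative (p : ℝ[X]) =
      C (M.width i)⁻¹ * (derivative (M.hat i p : ℝ[X])).comp (M.ofCell i) := by
  rw [← derivative_comp_ofCell, hat_comp_ofCell]

lemma degree_hat_le (p : degreeLE ℝ (k : WithBot ℕ)) : (M.hat i p : ℝ[X]).degree ≤ k :=
  mem_degreeLE.mp (M.hat i p).2

variable (A : M.Weights)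

lemma quad_add (p q : ℝ[X]) : M.quad A i (p + q) = M.quad A i p + M.quad A i q := by
  simp [quad, mul_add, Finset.sum_add_distrib]

lemma quad_C_mul (c : ℝ) (p : ℝ[X]) : M.quad A i (C c * p) = c * M.quad A i p := by
  simp [quad, Finset.mul_sum, mul_left_comm]

/-- The error of the quadrature rule of cell `i`, transported to the unit cell. -/
def quadError : ℝ[X] →ₗ[ℝ] ℝ where
  toFun p := unitInt p - (M.width i)⁻¹ * M.quad A i (p.comp (M.ofCell i))
  map_add' p q := by
    rw [map_add, add_comp, quad_add]
    ring
  map_smul' c p := by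
    rw [map_smul, smul_eq_C_mul, mul_comp, C_comp, quad_C_mul, smul_eq_mul, RingHom.id_apply,
      smul_eq_mul]
    ring

lemma quadError_apply (p : ℝ[X]) :
    M.quadError i A p = unitInt p - (M.width i)⁻¹ * M.quad A i (p.comp (M.ofCell i)) := rfl

lemma quad_comp_ofCell (p : ℝ[X]) :
    M.quad A i (p.comp (M.ofCell i)) = M.width i * (unitInt p - M.quadError i A p) := by
  rw [quadError_apply, sub_sub_cancel, mul_inv_cancel_left₀ (M.width_pos i).ne']

lemma legendre_eq (n : ℕ) : M.legendre i n = (unitLegendre n).comp (M.ofCell i) := by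
  rw [legendre, unitLegendre, mul_comp, C_comp, ofCell]

lemma quadError_eq_zero {M : SVMesh k} (i : Fin (M.m + 1)) {A : M.Weights} {δ : ℝ}
    (hA : M.SubdivisionAssumption A δ) {p : ℝ[X]} (hp : p.degree < ((2 * k : ℕ) : WithBot ℕ)) :
    M.quadError i A p = 0 := by
  have hd : (p.comp (M.ofCell i)).degree < ((2 * k : ℕ) : WithBot ℕ) := by
    by_cases h0 : p = 0
    · simpa [h0] using hp
    · rw [degree_eq_natDegree h0] at hp
      exact (degree_comp_le (M.natDegree_ofCell_le i) degree_le_natDegree).trans_lt hp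
  rw [quadError_apply, hA.exact i _ hd, integral_cell, comp_ofCell_comp_toCell,
    inv_mul_cancel_left₀ (M.width_pos i).ne', sub_self]

end Cell

end SVMesh

/-! ### The trial-to-test mapping and the passage to the Galerkin form. -/

namespace SVMesh

variable {k : ℕ}

section Mapping

variable (M : SVMesh k) (A : M.Weights)

lemma mstar_zero (hU : M.Upwind A) (w : M.Space) (i : Fin (M.m + 1)) :
    M.mstar A w i 0 = M.leftTrace w i := by
  simp [mstar, hU i]

lemma mstar_succ (w : M.Space) (i : Fin (M.m + 1)) (j : Fin k) :
    M.mstar A w i j.succ = M.mstar A w i j.castSucc +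
      A i j.succ.castSucc * (derivative (w i : ℝ[X])).eval (M.pt i j.succ.castSucc) := by
  obtain _ | k := k
  · exact j.elim0
  · simp [mstar, Fin.induction_succ]

lemma quad_eq_of_upwind (hU : M.Upwind A) (i : Fin (M.m + 1)) (p : ℝ[X]) :
    M.quad A i p = ∑ j : Fin k, A i j.succ.castSucc * p.eval (M.pt i j.succ.castSucc) +
      A i (Fin.last _) * p.eval (M.right i) := by
  rw [quad, Fin.sum_univ_succ, Fin.sum_univ_castSucc, hU i, zero_mul, zero_add, Fin.succ_last,
    M.pt_last]
  simp only [Fin.succ_castSucc]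
  rfl

variable {M A} {δ : ℝ}

lemma quad_derivative (hA : M.SubdivisionAssumption A δ) (i : Fin (M.m + 1)) (w : M.Space) :
    M.quad A i (derivative (w i : ℝ[X])) = M.rightTrace w i - M.leftTrace w i := by
  have hd : (derivative (w i : ℝ[X])).degree < ((2 * k : ℕ) : WithBot ℕ) := by
    have hw : (w i : ℝ[X]).degree ≤ k := mem_degreeLE.mp (w i).2
    by_cases h0 : (w i : ℝ[X]) = 0
    · rw [h0, derivative_zero, degree_zero]
      exact WithBot.bot_lt_coe _
    · refine (degree_derivative_lt h0).trans_le (hw.trans ?_)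
      exact_mod_cast (by omega : k ≤ 2 * k)
  rw [hA.exact i _ hd, integral_eval_derivative, rightTrace, leftTrace]

/-- The increments of `M^* ω` are the interior quadrature terms of `ω_x`. By exactness they sum to
the increment of `ω` over the cell, less the term of the last node. -/
lemma mstar_last (hA : M.SubdivisionAssumption A δ) (hU : M.Upwind A) (w : M.Space)
    (i : Fin (M.m + 1)) : M.mstar A w i (Fin.last k) =
      M.rightTrace w i - A i (Fin.last _) * (derivative (w i : ℝ[X])).eval (M.right i) := by
  have h := last_eq_add_sum _ _ (M.mstar_succ A w i)
  have hq := quad_derivative hA i w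
  rw [quad_eq_of_upwind M A hU] at hq
  rw [mstar_zero M A hU] at h
  linarith

/-- Summation by parts for the trial-to-test mapping. -/
lemma sum_sub_mul_mstar (hA : M.SubdivisionAssumption A δ) (hU : M.Upwind A) (w : M.Space)
    (i : Fin (M.m + 1)) (F : Fin (k + 2) → ℝ) (p : ℝ[X])
    (hF : ∀ j : Fin (k + 1), F j.succ = p.eval (M.pt i j.succ)) :
    ∑ j, (F j.succ - F j.castSucc) * M.mstar A w i j =
      p.eval (M.right i) * M.rightTrace w i - F 0 * M.leftTrace w i -
        M.quad A i (p * derivative (w i : ℝ[X])) := by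
  rw [sum_sub_mul_eq F _ _ (M.mstar_succ A w i), mstar_last hA hU, mstar_zero M A hU,
    quad_eq_of_upwind M A hU, ← Fin.succ_last, hF, Fin.succ_last, M.pt_last]
  have : ∀ j : Fin k, F j.succ.castSucc *
      (A i j.succ.castSucc * (derivative (w i : ℝ[X])).eval (M.pt i j.succ.castSucc)) =
      A i j.succ.castSucc * (p * derivative (w i : ℝ[X])).eval (M.pt i j.succ.castSucc) := by
    intro j
    rw [← Fin.succ_castSucc, hF, eval_mul]
    ring
  rw [Finset.sum_congr rfl fun j _ => this j, eval_mul]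
  change p.eval (M.right i) * _ - _ - _ = _
  ring

/-- Summation by parts turns the cell energy into a boundary term minus the quadrature of `V w'`;
replacing the quadrature by the integral minus its error recovers `∫ v w`. -/
lemma sum_cvIntegral_mul_mstar (hA : M.SubdivisionAssumption A δ) (hU : M.Upwind A)
    (v w : M.Space) (i : Fin (M.m + 1)) {V : ℝ[X]}
    (hV : derivative V = (M.hat i (v i) : ℝ[X])) (hV0 : V.eval 0 = 0) :
    ∑ j, M.cvIntegral v i j * M.mstar A w i j = M.width i *
      (unitInt ((M.hat i (v i) : ℝ[X]) * M.hat i (w i)) +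
        M.quadError i A (V * derivative (M.hat i (w i) : ℝ[X]))) := by
  have hw := (M.width_pos i).ne'
  set P : ℝ[X] := C (M.width i) * V.comp (M.ofCell i) with hP
  have hPd : derivative P = (v i : ℝ[X]) := by
    rw [hP, derivative_C_mul, derivative_comp_ofCell, hV, ← mul_assoc, ← C_mul, mul_inv_cancel₀ hw,
      C_1, one_mul, hat_comp_ofCell]
  have hcv : ∀ j, M.cvIntegral v i j =
      P.eval (M.pt i j.succ) - P.eval (M.pt i j.castSucc) := by
    intro j
    rw [cvIntegral, ← hPd, integral_eval_derivative]
  have hP0 : P.eval (M.pt i 0) = 0 := by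
    rw [M.pt_zero, hP, eval_mul, eval_comp]
    change _ * V.eval ((M.ofCell i).eval (M.left i)) = 0
    rw [eval_ofCell_left, hV0, mul_zero]
  have hP1 : P.eval (M.right i) = M.width i * V.eval 1 := by
    rw [hP, eval_mul, eval_C, eval_comp, eval_ofCell_right]
  have hPw : P * derivative (w i : ℝ[X]) =
      (V * derivative (M.hat i (w i) : ℝ[X])).comp (M.ofCell i) := by
    have hC : C (M.width i) * C (M.width i)⁻¹ = (1 : ℝ[X]) := by
      rw [← C_mul, mul_inv_cancel₀ hw, C_1]
    rw [hP, derivative_eq_hat M i (w i), mul_comp]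
    linear_combination (V.comp (M.ofCell i) *
      (derivative (M.hat i (w i) : ℝ[X])).comp (M.ofCell i)) * hC
  have hI := unitInt_derivative_mul V (M.hat i (w i) : ℝ[X])
  rw [hV, hV0, eval_hat_one] at hI
  rw [Finset.sum_congr rfl fun j _ => by rw [hcv j],
    sum_sub_mul_mstar hA hU w i (fun j => P.eval (M.pt i j)) P (fun _ => rfl), hP0, hP1, hPw,
    quad_comp_ofCell, hI, rightTrace]
  ring

lemma sum_flux_mul_mstar (hA : M.SubdivisionAssumption A δ) (hU : M.Upwind A) (β : ℝ)
    (v w : M.Space) :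
    ∑ i, ∑ j, (M.flux β v i j.castSucc - M.flux β v i j.succ) * M.mstar A w i j =
      M.svForm A β v w := by
  have hcell : ∀ i, ∑ j, (M.flux β v i j.castSucc - M.flux β v i j.succ) * M.mstar A w i j =
      β * M.quad A i ((v i : ℝ[X]) * derivative (w i : ℝ[X])) +
        β * (M.rightTrace v (i - 1) * M.leftTrace w i) -
        β * (M.rightTrace v i * M.rightTrace w i) := by
    intro i
    have h := sum_sub_mul_mstar hA hU w i (M.flux β v i) (C β * (v i : ℝ[X])) (fun j => by
      simp [flux, Fin.succ_ne_zero])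
    have e : ∀ j : Fin (k + 1),
        (M.flux β v i j.castSucc - M.flux β v i j.succ) * M.mstar A w i j =
        -((M.flux β v i j.succ - M.flux β v i j.castSucc) * M.mstar A w i j) := fun j => by ring
    rw [Finset.sum_congr rfl fun j _ => e j, Finset.sum_neg_distrib, h, mul_assoc, quad_C_mul]
    simp only [flux, if_true, rightTrace, eval_mul, eval_C]
    ring
  -- Periodicity: reindexing pairs the inflow of each cell with the outflow of its left neighbour,
  -- producing the jumps of `w`.
  have hshift : ∑ i, M.rightTrace v (i - 1) * M.leftTrace w i =
      ∑ i, M.rightTrace v i * M.leftTrace w (i + 1) := by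
    rw [← Equiv.sum_comp (Equiv.addRight (1 : Fin (M.m + 1)))]
    simp
  have hU' : ∑ i, A (i + 1) 0 * (derivative (w (i + 1) : ℝ[X])).eval (M.left (i + 1)) *
      M.jump v i = 0 := Finset.sum_eq_zero fun i _ => by rw [hU (i + 1), zero_mul, zero_mul]
  rw [Finset.sum_congr rfl fun i _ => hcell i, Finset.sum_sub_distrib, Finset.sum_add_distrib,
    ← Finset.mul_sum, ← Finset.mul_sum, ← Finset.mul_sum, hshift, svForm, hU']
  simp only [jump, mul_sub, Finset.sum_sub_distrib]
  ring

/-- Weight each control-volume equation by the value of `M^* ω` there and sum. -/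
theorem IsRKSVStep.galerkin (hA : M.SubdivisionAssumption A δ) (hU : M.Upwind A) {rk : RKMethod}
    {β τ : ℝ} {u u' : M.Space} (h : M.IsRKSVStep rk β τ u u') :
    M.IsGalerkinRKSVStep A rk β τ u u' := by
  obtain ⟨w, h0, hs, hw⟩ := h
  refine ⟨w, h0, hs, fun ℓ hℓ ω => ?_⟩
  simp only [← sum_flux_mul_mstar hA hU, ipStar, hw ℓ hℓ, Finset.sum_mul]
  rw [Finset.sum_congr rfl fun i _ => Finset.sum_comm, Finset.sum_comm]
  refine Finset.sum_congr rfl fun κ _ => ?_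
  simp only [Finset.mul_sum, ← Finset.sum_add_distrib]
  refine Finset.sum_congr rfl fun i _ => Finset.sum_congr rfl fun j _ => ?_
  ring

end Mapping

end SVMesh

/-! ### Inverse estimates for the terms of the form. -/

section UnitForms

variable (k : ℕ)

/-- `∫ p q'` on the unit cell. -/
def unitDerivForm :
    degreeLE ℝ (k : WithBot ℕ) →ₗ[ℝ] degreeLE ℝ (k : WithBot ℕ) →ₗ[ℝ] ℝ :=
  LinearMap.mk₂ ℝ (fun p q => unitInt ((p : ℝ[X]) * derivative (q : ℝ[X])))
    (fun p q r => by simp [add_mul]) (fun c p q => by simp)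
    (fun p q r => by simp [mul_add]) (fun c p q => by simp)

/-- The product of point values on the unit cell. -/
def unitTraceForm (a b : ℝ) :
    degreeLE ℝ (k : WithBot ℕ) →ₗ[ℝ] degreeLE ℝ (k : WithBot ℕ) →ₗ[ℝ] ℝ :=
  LinearMap.mk₂ ℝ (fun p q => (p : ℝ[X]).eval a * (q : ℝ[X]).eval b)
    (fun p q r => by simp [add_mul]) (fun c p q => by simp [mul_assoc])
    (fun p q r => by simp [mul_add]) (fun c p q => by simp [mul_left_comm])

/-- The inverse estimates on the unit cell. -/
theorem exists_inverse_estimate : ∃ c : ℝ, 0 ≤ c ∧ ∀ p q : degreeLE ℝ (k : WithBot ℕ),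
    |unitInt ((p : ℝ[X]) * derivative (q : ℝ[X]))| ≤
      c * (√(unitInt ((p : ℝ[X]) * p)) * √(unitInt ((q : ℝ[X]) * q))) ∧
    |(p : ℝ[X]).eval 1 * (q : ℝ[X]).eval 0| ≤
      c * (√(unitInt ((p : ℝ[X]) * p)) * √(unitInt ((q : ℝ[X]) * q))) ∧
    |(p : ℝ[X]).eval 1 * (q : ℝ[X]).eval 1| ≤
      c * (√(unitInt ((p : ℝ[X]) * p)) * √(unitInt ((q : ℝ[X]) * q))) := by
  obtain ⟨c₁, h₁, hb₁⟩ := exists_bilin_bound (unitDerivForm k)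
  obtain ⟨c₂, h₂, hb₂⟩ := exists_bilin_bound (unitTraceForm k 1 0)
  obtain ⟨c₃, h₃, hb₃⟩ := exists_bilin_bound (unitTraceForm k 1 1)
  refine ⟨c₁ + c₂ + c₃, by positivity, fun p q => ⟨?_, ?_, ?_⟩⟩
  · refine (hb₁ p q).trans ?_
    rw [mul_assoc]
    gcongr
    linarith
  · refine (hb₂ p q).trans ?_
    rw [mul_assoc]
    gcongr
    linarith
  · refine (hb₃ p q).trans ?_
    rw [mul_assoc]
    gcongr
    linarith

end UnitForms

/-! ### Dissipativity, boundedness and coercivity on the mesh. -/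

namespace SVMesh

variable {k : ℕ}

section Forms

variable (M : SVMesh k) (A : M.Weights)

lemma cvIntegral_add (u v : M.Space) (i : Fin (M.m + 1)) (j : Fin (k + 1)) :
    M.cvIntegral (u + v) i j = M.cvIntegral u i j + M.cvIntegral v i j := by
  simp only [cvIntegral, Pi.add_apply, Submodule.coe_add, eval_add]
  exact intervalIntegral.integral_add ((u i : ℝ[X]).continuous.intervalIntegrable _ _)
    ((v i : ℝ[X]).continuous.intervalIntegrable _ _)

lemma cvIntegral_smul (c : ℝ) (v : M.Space) (i : Fin (M.m + 1)) (j : Fin (k + 1)) :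
    M.cvIntegral (c • v) i j = c * M.cvIntegral v i j := by
  simp [cvIntegral]

lemma mstar_add (u v : M.Space) (i : Fin (M.m + 1)) (j : Fin (k + 1)) :
    M.mstar A (u + v) i j = M.mstar A u i j + M.mstar A v i j := by
  induction j using Fin.induction with
  | zero =>
    simp only [mstar, Fin.induction_zero, leftTrace, Pi.add_apply, Submodule.coe_add, eval_add,
      derivative_add]
    ring
  | succ j ih =>
    rw [mstar_succ, mstar_succ, mstar_succ, ih]
    simp only [Pi.add_apply, Submodule.coe_add, eval_add, derivative_add]
    ring

lemma mstar_smul (c : ℝ) (v : M.Space) (i : Fin (M.m + 1)) (j : Fin (k + 1)) :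
    M.mstar A (c • v) i j = c * M.mstar A v i j := by
  induction j using Fin.induction with
  | zero =>
    simp only [mstar, Fin.induction_zero, leftTrace, Pi.smul_apply, Submodule.coe_smul, eval_smul,
      derivative_smul, smul_eq_mul]
    ring
  | succ j ih =>
    rw [mstar_succ, mstar_succ, ih]
    simp only [Pi.smul_apply, Submodule.coe_smul, eval_smul, derivative_smul, smul_eq_mul]
    ring

/-- The form `⟨v, ω⟩_*` as a bilinear map. -/
def energyForm : M.Space →ₗ[ℝ] M.Space →ₗ[ℝ] ℝ :=
  LinearMap.mk₂ ℝ (M.ipStar A)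
    (fun u v w => by simp [ipStar, cvIntegral_add, add_mul, Finset.sum_add_distrib])
    (fun c v w => by simp [ipStar, cvIntegral_smul, mul_assoc, Finset.mul_sum])
    (fun u v w => by simp [ipStar, mstar_add, mul_add, Finset.sum_add_distrib])
    (fun c v w => by simp [ipStar, mstar_smul, mul_left_comm, Finset.mul_sum])

/-- The spectral volume form in terms of pull-backs to the unit cell, when the quadrature rules
are exact. -/
def transportForm (β : ℝ) (v w : M.Space) : ℝ :=
  β * ∑ i, (unitInt ((M.hat i (v i) : ℝ[X]) * derivative (M.hat i (w i) : ℝ[X])) +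
    (M.hat i (v i) : ℝ[X]).eval 1 * (M.hat (i + 1) (w (i + 1)) : ℝ[X]).eval 0 -
    (M.hat i (v i) : ℝ[X]).eval 1 * (M.hat i (w i) : ℝ[X]).eval 1)

/-- The spectral volume form as a bilinear map, when the quadrature rules are exact. -/
def transportBilin (β : ℝ) : M.Space →ₗ[ℝ] M.Space →ₗ[ℝ] ℝ :=
  LinearMap.mk₂ ℝ (M.transportForm β)
    (fun u v w => by
      simp only [transportForm, Pi.add_apply, map_add, Submodule.coe_add, add_mul, eval_add,
        ← mul_add, ← Finset.sum_add_distrib]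
      congr 2 with i
      ring)
    (fun c v w => by
      simp only [transportForm, Pi.smul_apply, map_smul, Submodule.coe_smul, smul_mul_assoc,
        eval_smul, smul_eq_mul, mul_left_comm c β, Finset.mul_sum]
      congr with i
      ring)
    (fun u v w => by
      simp only [transportForm, Pi.add_apply, map_add, Submodule.coe_add, eval_add,
        ← mul_add, ← Finset.sum_add_distrib]
      congr 2 with i
      rw [mul_add, map_add]
      ring)
    (fun c v w => by
      simp only [transportForm, Pi.smul_apply, map_smul, Submodule.coe_smul, mul_smul_comm,
        eval_smul, smul_eq_mul, mul_left_comm c β, Finset.mul_sum]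
      congr with i
      ring)

lemma sum_shift (f : Fin (M.m + 1) → ℝ) : ∑ i, f (i + 1) = ∑ i, f i :=
  Equiv.sum_comp (Equiv.addRight (1 : Fin (M.m + 1))) f

theorem transportForm_self_nonpos {β : ℝ} (hβ : 0 < β) (v : M.Space) :
    M.transportForm β v v ≤ 0 := by
  refine mul_nonpos_of_nonneg_of_nonpos hβ.le ?_
  have h : ∀ i, unitInt ((M.hat i (v i) : ℝ[X]) * derivative (M.hat i (v i) : ℝ[X])) =
      ((M.hat i (v i) : ℝ[X]).eval 1 ^ 2 - (M.hat i (v i) : ℝ[X]).eval 0 ^ 2) / 2 := by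
    intro i
    have := unitInt_derivative_mul (M.hat i (v i) : ℝ[X]) (M.hat i (v i) : ℝ[X])
    rw [mul_comm (derivative _)] at this
    linarith
  have hs := M.sum_shift fun i => (M.hat i (v i) : ℝ[X]).eval 0 ^ 2 / 2
  -- The sum equals minus half the squared jumps plus a difference that vanishes by periodicity.
  have e : ∑ i, (unitInt ((M.hat i (v i) : ℝ[X]) * derivative (M.hat i (v i) : ℝ[X])) +
      (M.hat i (v i) : ℝ[X]).eval 1 * (M.hat (i + 1) (v (i + 1)) : ℝ[X]).eval 0 -
      (M.hat i (v i) : ℝ[X]).eval 1 * (M.hat i (v i) : ℝ[X]).eval 1) =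
      -∑ i, ((M.hat (i + 1) (v (i + 1)) : ℝ[X]).eval 0 - (M.hat i (v i) : ℝ[X]).eval 1) ^ 2 / 2 +
      (∑ i, (M.hat (i + 1) (v (i + 1)) : ℝ[X]).eval 0 ^ 2 / 2 -
        ∑ i, (M.hat i (v i) : ℝ[X]).eval 0 ^ 2 / 2) := by
    rw [← Finset.sum_neg_distrib, ← Finset.sum_sub_distrib, ← Finset.sum_add_distrib]
    refine Finset.sum_congr rfl fun i _ => ?_
    rw [h]
    ring
  rw [e, hs, sub_self, add_zero, neg_nonpos]
  exact Finset.sum_nonneg fun i _ => by positivity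

/-- No mesh size appears: the `h_i` from integration cancels the `1/h_i` from differentiation. -/
theorem abs_transportForm_le {β c : ℝ} (hβ : 0 < β) (hc : 0 ≤ c)
    (hinv : ∀ p q : degreeLE ℝ (k : WithBot ℕ),
      |unitInt ((p : ℝ[X]) * derivative (q : ℝ[X]))| ≤
        c * (√(unitInt ((p : ℝ[X]) * p)) * √(unitInt ((q : ℝ[X]) * q))) ∧
      |(p : ℝ[X]).eval 1 * (q : ℝ[X]).eval 0| ≤
        c * (√(unitInt ((p : ℝ[X]) * p)) * √(unitInt ((q : ℝ[X]) * q))) ∧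
      |(p : ℝ[X]).eval 1 * (q : ℝ[X]).eval 1| ≤
        c * (√(unitInt ((p : ℝ[X]) * p)) * √(unitInt ((q : ℝ[X]) * q))))
    (v w : M.Space) :
    |M.transportForm β v w| ≤ 3 * β * c *
      (√(∑ i, unitInt ((M.hat i (v i) : ℝ[X]) * M.hat i (v i))) *
        √(∑ i, unitInt ((M.hat i (w i) : ℝ[X]) * M.hat i (w i)))) := by
  set n : M.Space → Fin (M.m + 1) → ℝ :=
    fun v i => √(unitInt ((M.hat i (v i) : ℝ[X]) * M.hat i (v i))) with hn
  have hsq : ∀ v, ∑ i, n v i ^ 2 = ∑ i, unitInt ((M.hat i (v i) : ℝ[X]) * M.hat i (v i)) :=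
    fun v => Finset.sum_congr rfl fun i _ => Real.sq_sqrt (unitInt_mul_self_nonneg _)
  have h1 : ∑ i, n v i * n w i ≤ √(∑ i, n v i ^ 2) * √(∑ i, n w i ^ 2) :=
    Real.sum_mul_le_sqrt_mul_sqrt _ _ _
  have h2 : ∑ i, n v i * n w (i + 1) ≤ √(∑ i, n v i ^ 2) * √(∑ i, n w i ^ 2) := by
    have := Real.sum_mul_le_sqrt_mul_sqrt Finset.univ (n v) (fun i => n w (i + 1))
    rwa [M.sum_shift fun i => n w i ^ 2] at this
  rw [← hsq, ← hsq]
  calc |M.transportForm β v w|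
      ≤ β * ∑ i, (c * (n v i * n w i) + c * (n v i * n w (i + 1)) + c * (n v i * n w i)) := by
        rw [transportForm, abs_mul, abs_of_pos hβ]
        refine mul_le_mul_of_nonneg_left ?_ hβ.le
        refine (Finset.abs_sum_le_sum_abs _ _).trans (Finset.sum_le_sum fun i _ => ?_)
        refine (abs_sub _ _).trans (add_le_add ((abs_add_le _ _).trans (add_le_add ?_ ?_)) ?_)
        · exact (hinv _ _).1
        · exact (hinv _ _).2.1
        · exact (hinv _ _).2.2
    _ = β * c * (∑ i, n v i * n w i + ∑ i, n v i * n w (i + 1) + ∑ i, n v i * n w i) := by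
        rw [Finset.sum_add_distrib, Finset.sum_add_distrib, ← Finset.mul_sum, ← Finset.mul_sum]
        ring
    _ ≤ β * c * (3 * (√(∑ i, n v i ^ 2) * √(∑ i, n w i ^ 2))) := by
        refine mul_le_mul_of_nonneg_left ?_ (by positivity)
        linarith
    _ = _ := by ring

variable {M A} {δ : ℝ}

lemma svForm_eq_transportForm (hA : M.SubdivisionAssumption A δ) (hU : M.Upwind A) (β : ℝ)
    (v w : M.Space) : M.svForm A β v w = M.transportForm β v w := by
  have hU' : ∑ i, A (i + 1) 0 * (derivative (w (i + 1) : ℝ[X])).eval (M.left (i + 1)) *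
      M.jump v i = 0 := Finset.sum_eq_zero fun i _ => by rw [hU (i + 1), zero_mul, zero_mul]
  have hq : ∀ i, M.quad A i ((v i : ℝ[X]) * derivative (w i : ℝ[X])) =
      unitInt ((M.hat i (v i) : ℝ[X]) * derivative (M.hat i (w i) : ℝ[X])) := by
    intro i
    have hd : ((M.hat i (v i) : ℝ[X]) * derivative (M.hat i (w i) : ℝ[X])).degree <
        ((2 * k : ℕ) : WithBot ℕ) := by
      by_cases h0 : (M.hat i (w i) : ℝ[X]) = 0
      · rw [h0, derivative_zero, mul_zero, degree_zero]
        exact WithBot.bot_lt_coe _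
      by_cases h1 : (M.hat i (v i) : ℝ[X]) = 0
      · rw [h1, zero_mul, degree_zero]
        exact WithBot.bot_lt_coe _
      · rw [degree_mul, degree_eq_natDegree h1]
        have h2 := degree_derivative_lt h0
        have hv := natDegree_le_of_degree_le (M.degree_hat_le i (v i))
        have hlt : (derivative (M.hat i (w i) : ℝ[X])).degree < (k : WithBot ℕ) :=
          h2.trans_le (M.degree_hat_le i (w i))
        by_cases h3 : derivative (M.hat i (w i) : ℝ[X]) = 0
        · rw [h3, degree_zero, WithBot.add_bot]
          exact WithBot.bot_lt_coe _
        · rw [degree_eq_natDegree h3] at hlt ⊢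
          have hlt' : (derivative (M.hat i (w i) : ℝ[X])).natDegree < k := by exact_mod_cast hlt
          exact_mod_cast (by omega :
            (M.hat i (v i) : ℝ[X]).natDegree + (derivative (M.hat i (w i) : ℝ[X])).natDegree <
              2 * k)
    have e : (v i : ℝ[X]) * derivative (w i : ℝ[X]) = C (M.width i)⁻¹ *
        ((M.hat i (v i) : ℝ[X]) * derivative (M.hat i (w i) : ℝ[X])).comp (M.ofCell i) := by
      rw [derivative_eq_hat M i (w i), mul_comp, hat_comp_ofCell]
      ring
    rw [e, quad_C_mul, quad_comp_ofCell, quadError_eq_zero i hA hd, sub_zero,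
      inv_mul_cancel_left₀ (M.width_pos i).ne']
  rw [svForm, hU', sub_zero, transportForm, ← Finset.sum_add_distrib]
  refine congrArg (β * ·) (Finset.sum_congr rfl fun i _ => ?_)
  rw [hq, jump, rightTrace, rightTrace, leftTrace, eval_hat_one, eval_hat_one, eval_hat_zero]
  ring

lemma ipStar_symm (hA : M.SubdivisionAssumption A δ) (hU : M.Upwind A) (v w : M.Space) :
    M.ipStar A v w = M.ipStar A w v := by
  refine Finset.sum_congr rfl fun i _ => ?_
  obtain ⟨V, hV, hV0, hVd⟩ := exists_antiderivative (M.degree_hat_le i (v i))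
  obtain ⟨W, hW, hW0, hWd⟩ := exists_antiderivative (M.degree_hat_le i (w i))
  have h := functional_symm (fun p hp => quadError_eq_zero i hA hp) hVd hWd
    (hV ▸ M.degree_hat_le i (v i)) (hW ▸ M.degree_hat_le i (w i))
  rw [hV, hW] at h
  rw [sum_cvIntegral_mul_mstar hA hU v w i hV hV0, sum_cvIntegral_mul_mstar hA hU w v i hW hW0, h,
    mul_comm (M.hat i (v i) : ℝ[X])]

theorem coercivity (hA : M.SubdivisionAssumption A δ) (hU : M.Upwind A) (v : M.Space) :
    coercivityConst k δ *
      ∑ i, M.width i * unitInt ((M.hat i (v i) : ℝ[X]) * M.hat i (v i)) ≤ M.ipStar A v v := by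
  rw [Finset.mul_sum]
  refine Finset.sum_le_sum fun i _ => ?_
  obtain ⟨V, hV, hV0, hVd⟩ := exists_antiderivative (M.degree_hat_le i (v i))
  rw [sum_cvIntegral_mul_mstar hA hU v v i hV hV0, mul_left_comm]
  refine mul_le_mul_of_nonneg_left ?_ (M.width_pos i).le
  have hw := M.width_pos i
  have hm : 1 ≤ k → δ ≤ 1 / (2 * (k : ℝ) - 1) +
      M.quadError i A (unitLegendre (k + 1) * unitLegendre (k - 1)) := by
    intro hk
    have h := hA.margin hk i
    -- The exact integral of `L_{k+1} L_{k-1}` is zero by orthogonality, so the quadrature value is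
    -- minus `h_i` times the error.
    rw [legendre_eq, legendre_eq, ← mul_comp, quad_comp_ofCell,
      unitInt_unitLegendre_mul ((degree_unitLegendre_le (k - 1)).trans
        (by exact_mod_cast (by omega : k - 1 ≤ k + 1))),
      coeff_eq_zero_of_degree_lt ((degree_unitLegendre_le (k - 1)).trans_lt
        (by exact_mod_cast (by omega : k - 1 < k + 1)))] at h
    refine le_of_mul_le_mul_right (h.trans_eq ?_) hw
    ring
  have h := coercivity_unit_cell (fun p hp => quadError_eq_zero i hA hp) hm hVd
    (hV ▸ M.degree_hat_le i (v i))
  rwa [hV] at h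

lemma ipStar_self_pos (hδ : 0 < δ) (hA : M.SubdivisionAssumption A δ) (hU : M.Upwind A)
    {v : M.Space} (hv : v ≠ 0) : 0 < M.ipStar A v v := by
  refine lt_of_lt_of_le (mul_pos (coercivityConst_pos k hδ) ?_) (coercivity hA hU v)
  obtain ⟨i, hi⟩ := Function.ne_iff.mp hv
  refine Finset.sum_pos' (fun j _ => mul_nonneg (M.width_pos j).le (unitInt_mul_self_nonneg _))
    ⟨i, Finset.mem_univ i, mul_pos (M.width_pos i) (unitInt_mul_self_pos fun h => hi ?_)⟩
  have := M.hat_comp_ofCell i (v i)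
  rw [h, zero_comp] at this
  exact Subtype.ext this.symm

/-- Source of the factor `1/h` in the operator bound: quasi-uniformity replaces each `h_i` by `h`.
-/
lemma sum_unitInt_le {μ : ℝ} (hμ : M.QuasiUniform μ) (hδ : 0 < δ)
    (hA : M.SubdivisionAssumption A δ) (hU : M.Upwind A) (v : M.Space) :
    ∑ i, unitInt ((M.hat i (v i) : ℝ[X]) * M.hat i (v i)) ≤
      |μ| / (M.size * coercivityConst k δ) * M.ipStar A v v := by
  have hc := coercivityConst_pos k hδ
  have hs := M.size_pos
  have h := coercivity hA hU v
  have h1 : M.size * ∑ i, unitInt ((M.hat i (v i) : ℝ[X]) * M.hat i (v i)) ≤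
      |μ| * ∑ i, M.width i * unitInt ((M.hat i (v i) : ℝ[X]) * M.hat i (v i)) := by
    rw [Finset.mul_sum, Finset.mul_sum]
    refine Finset.sum_le_sum fun i _ => ?_
    rw [← mul_assoc]
    refine mul_le_mul_of_nonneg_right ((hμ i).trans ?_) (unitInt_mul_self_nonneg _)
    exact mul_le_mul_of_nonneg_right (le_abs_self μ) (M.width_pos i).le
  rw [div_mul_eq_mul_div, le_div_iff₀ (by positivity)]
  have h2 := mul_le_mul_of_nonneg_left h (abs_nonneg μ)
  have h3 := mul_le_mul_of_nonneg_right h1 hc.le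
  linarith

end Forms

end SVMesh

/-! ### One step of the scheme, and the method with `C = 0`. -/

namespace SVMesh

variable {k : ℕ}

lemma finiteDimensional_space (M : SVMesh k) : FiniteDimensional ℝ M.Space := by
  have := finiteDimensional_degreeLE k
  infer_instance

lemma normStar_sq {M : SVMesh k} {A : M.Weights} {δ : ℝ} (hδ : 0 < δ)
    (hA : M.SubdivisionAssumption A δ) (hU : M.Upwind A) (v : M.Space) :
    M.normStar A v ^ 2 = M.ipStar A v v := by
  refine Real.sq_sqrt ?_
  by_cases h : v = 0
  · simpa [h] using (show M.energyForm A 0 0 = M.ipStar A 0 0 from rfl).le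
  · exact (ipStar_self_pos hδ hA hU h).le

end SVMesh

/-- One step of the scheme, under a step-size restriction that depends on `k`, `β`, `μ`, `δ`. -/
theorem exists_step_bound (k : ℕ) {β : ℝ} (μ : ℝ) {δ : ℝ} (hβ : 0 < β) (hδ : 0 < δ) :
    ∃ G : ℝ, 0 ≤ G ∧ ∀ (M : SVMesh k) (A : M.Weights), M.QuasiUniform μ →
      M.SubdivisionAssumption A δ → M.Upwind A → ∀ (rk : RKMethod) (τ : ℝ), 0 < τ →
      G * (τ / M.size) ≤ 1 → ∀ u u' : M.Space,
      M.IsRKSVStep rk β τ u u' ∨ M.IsGalerkinRKSVStep A rk β τ u u' →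
      ((rk.stagePoly rk.s).coeff 0 = 1 → (rk.stagePoly rk.s).coeff 1 = 1 →
        M.normStar A u' ^ 2 ≤
          (1 + growthConst (rk.stagePoly rk.s) * (G * (τ / M.size)) ^ 2) * M.normStar A u ^ 2) ∧
      (rk.stagePoly rk.s = 1 + X + X ^ 2 → M.normStar A u' ^ 2 ≤ M.normStar A u ^ 2) := by
  obtain ⟨c, hc, hinv⟩ := exists_inverse_estimate k
  have hcc := coercivityConst_pos k hδ
  refine ⟨3 * β * c * (|μ| / coercivityConst k δ), by positivity, ?_⟩
  intro M A hμ hA hU rk τ hτ hθ u u' hstep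
  have hs := M.size_pos
  obtain ⟨w, rfl, rfl, hw⟩ : M.IsGalerkinRKSVStep A rk β τ u u' :=
    hstep.elim (fun h => h.galerkin hA hU) id
  have := M.finiteDimensional_space
  set a := |μ| / (M.size * coercivityConst k δ) with ha
  have ha0 : 0 ≤ a := by positivity
  have hbound : ∀ v z : M.Space, |M.transportBilin β v z| ≤
      3 * β * c * a * √(M.energyForm A v v) * √(M.energyForm A z z) := by
    intro v z
    refine (M.abs_transportForm_le hβ hc hinv v z).trans ?_
    have hle : ∀ y : M.Space,
        √(∑ i, unitInt ((M.hat i (y i) : ℝ[X]) * M.hat i (y i))) ≤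
          √a * √(M.ipStar A y y) := fun y => by
      rw [← Real.sqrt_mul ha0]
      exact Real.sqrt_le_sqrt (SVMesh.sum_unitInt_le hμ hδ hA hU y)
    calc _ ≤ 3 * β * c * ((√a * √(M.ipStar A v v)) * (√a * √(M.ipStar A z z))) := by
          gcongr
          · exact hle v
          · exact hle z
      _ = 3 * β * c * (√a * √a) * √(M.ipStar A v v) * √(M.ipStar A z z) := by ring
      _ = _ := by
          rw [Real.mul_self_sqrt ha0]
          rfl
  have hmain := galerkin_energy_le (B := M.energyForm A) (H := M.transportBilin β)
    (SVMesh.ipStar_symm hA hU) (fun v hv => SVMesh.ipStar_self_pos hδ hA hU hv)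
    (M.transportForm_self_nonpos hβ) hbound rk hτ.le
    -- `θ` is exactly `τ Λ`, with `Λ = 3 β c a` from `hbound`.
    (θ := 3 * β * c * (|μ| / coercivityConst k δ) * (τ / M.size)) (by positivity)
    (le_of_eq (by rw [ha]; field_simp)) hθ (w := w) (fun ℓ hℓ ω => by
      refine (hw ℓ hℓ ω).trans (Finset.sum_congr rfl fun κ _ => ?_)
      rw [SVMesh.svForm_eq_transportForm hA hU]
      rfl)
  simp only [SVMesh.normStar_sq hδ hA hU]
  exact hmain

/-- The two-stage method with stability polynomial `1 + z + z ^ 2`. -/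
def twoStageMethod : RKMethod where
  s := 2
  c ℓ κ := if κ = 0 then 1 else 0
  d ℓ κ := if κ = ℓ then 1 else 0
  sum_c ℓ _ := by simp

lemma stagePoly_twoStageMethod : twoStageMethod.stagePoly twoStageMethod.s = 1 + X + X ^ 2 := by
  change twoStageMethod.stagePoly 2 = _
  simp [RKMethod.stagePoly, twoStageMethod, Fin.sum_univ_succ]
  ring

/-- The order is only `1`: the coefficient of `z ^ 2` is `1` rather than `1/2`. -/
lemma hasOrder_twoStageMethod : twoStageMethod.HasOrder 1 := by
  intro m hm
  rw [stagePoly_twoStageMethod]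
  interval_cases m <;> simp [coeff_X, coeff_one, coeff_X_pow]

end SpectralVolume
end

/-! ### The main theorem. -/

open SpectralVolume
theorem mainTheorem7 :
    (∀ (rk : RKMethod) (r : ℕ), 1 ≤ r → rk.HasOrder r →
      ∃ γ₀ : ℝ, 2 ≤ γ₀ ∧
        ∀ (k : ℕ) (β μ δ : ℝ), 0 < β → 0 < δ →
          ∃ Ccfl : ℝ, 0 < Ccfl ∧ ∃ K : ℝ, 0 ≤ K ∧ WeakStability rk k β μ δ Ccfl γ₀ K) ∧
    (∃ (rk : RKMethod) (r : ℕ), 1 ≤ r ∧ rk.HasOrder r ∧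
      ∀ (k : ℕ) (β μ δ : ℝ), 0 < β → 0 < δ →
        ∃ Ccfl : ℝ, 0 < Ccfl ∧ WeakStability rk k β μ δ Ccfl 2 0) := by
  have hcfl : ∀ {G x : ℝ}, 0 ≤ G → x ≤ 1 / (G + 1) → G * x ≤ 1 := by
    intro G x hG hx
    calc G * x ≤ G * (1 / (G + 1)) := mul_le_mul_of_nonneg_left hx hG
      _ ≤ 1 := by
        rw [mul_one_div, div_le_one (by positivity)]
        linarith
  have hstep : ∀ {k : ℕ} {M : SVMesh k} {A : M.Weights} {rk : RKMethod} {β τ : ℝ} {N : ℕ}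
      {u : ℕ → M.Space}, ((∀ n < N, M.IsRKSVStep rk β τ (u n) (u (n + 1))) ∨
        (∀ n < N, M.IsGalerkinRKSVStep A rk β τ (u n) (u (n + 1)))) → ∀ n < N,
        M.IsRKSVStep rk β τ (u n) (u (n + 1)) ∨ M.IsGalerkinRKSVStep A rk β τ (u n) (u (n + 1)) :=
    fun h n hn => h.imp (fun h => h n hn) (fun h => h n hn)
  constructor
  · intro rk r hr hord
    refine ⟨2, le_rfl, fun k β μ δ hβ hδ => ?_⟩
    obtain ⟨G, hG, h⟩ := exists_step_bound k μ hβ hδ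
    -- `G + 1` instead of `G` keeps the step-size bound meaningful when `G = 0`; the constant comes
    -- from squaring `θ = G τ / h`.
    refine ⟨1 / (G + 1), by positivity, growthConst (rk.stagePoly rk.s) * G ^ 2,
      mul_nonneg (growthConst_nonneg _) (sq_nonneg G), ?_⟩
    intro M A hμ hA hU τ hτ hle N u hu n hn
    have := (h M A hμ hA hU rk τ hτ (hcfl hG hle) _ _ (hstep hu n hn)).1
      (by simpa using hord 0 (Nat.zero_le r)) (by simpa using hord 1 hr)
    rw [mul_pow, ← mul_assoc] at this
    rwa [Real.rpow_two]
  · refine ⟨twoStageMethod, 1, le_rfl, hasOrder_twoStageMethod, fun k β μ δ hβ hδ => ?_⟩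
    obtain ⟨G, hG, h⟩ := exists_step_bound k μ hβ hδ
    refine ⟨1 / (G + 1), by positivity, ?_⟩
    intro M A hμ hA hU τ hτ hle N u hu n hn
    rw [zero_mul, add_zero, one_mul]
    exact (h M A hμ hA hU _ τ hτ (hcfl hG hle) _ _ (hstep hu n hn)).2 stagePoly_twoStageMethod
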